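/- **Theorem.** Let $X$ be a path-connected metric space that is an absolute neighbourhood retract (for metric spaces), let $R$ be a ring (associative with unit), and let $n\ge 0$. *Symmetric power.* For $m\ge 1$ let $SP^m(X)=X^m/S_m$ be the orbit space, with the quotient topology, of the action of the symmetric group $S_m$ on $X^m$ by permutation of coordinates, and let $\delta_m:X\to SP^m(X)$, $\delta_m(x)=[x,\dots,x]$, be the diagonal embedding. *Distributional LS-category.* Let $P(X)$ be the space of all continuous paths $[0,1]\to X$ with the metric of uniform convergence (inducing the compact-open topology). For a metric space $Z$ let $\mathcal B_k(Z)$ be the set of Borel probability measures on $Z$ supported by at most $k$ points, with the Lévy–Prokhorov metric. The space $X$ is called $k$-contractible if there are a point $x_0\in X$ and a continuous map $H:X\to\mathcal B_k(P(X))$ such that for every $x\in X$ each path $\phi$ in the support of $H(x)$ satisfies $\phi(0)=x$ and $\phi(1)=x_0$. The distributional LS-category $d\mathrm{cat}(X)\in\{0,1,2,\dots\}\cup\{\infty\}$ is the least $k$ such that $X$ is $(k+1)$-contractible, and $\infty$ if there is no such $k$. *Claim.* Let $k_1,\dots,k_n\ge 1$ be integers, let $\alpha_i^*\in H^{k_i}(SP^{n!}(X);R)$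 for $1\le i\le n$, and let $\alpha_i=\delta_{n!}^*(\alpha_i^*)\in H^{k_i}(X;R)$ (singular cohomology). If $$\alpha_1\smile\alpha_2\smile\cdots\smile\alpha_n\neq 0\quad\text{in } H^{k_1+\cdots+k_n}(X;R),$$ then $$d\mathrm{cat}(X)\ \ge\ n.$$ -/

import Mathlib

open CategoryTheory Opposite MeasureTheory

universe u v

noncomputable section

namespace DCat

/-! ## Cohomology of simplicial sets and singular cohomology of spaces, with cup products -/

section Cohomology

variable (S : SSet.{u}) (R : Type v) [Ring R]

/-- The set of `n`-simplices. -/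
abbrev Simplices (S : SSet.{u}) (n : ℕ) : Type u := S.obj (op (SimplexCategory.mk n))

/-- `k`-cochains: arbitrary functions from the `k`-simplices to the coefficient ring. -/
abbrev Cochain (k : ℕ) : Type (max u v) := Simplices S k → R

/-- The coboundary `(d φ)(σ) = ∑ᵢ (-1)ⁱ φ(∂ᵢ σ)`. -/
def coboundary (k : ℕ) : Cochain S R k →+ Cochain S R (k + 1) where
  toFun φ := fun σ => ∑ i : Fin (k + 2), (-1 : ℤ) ^ (i : ℕ) • φ (S.δ i σ)
  map_zero' := by funext σ; simp
  map_add' φ ψ := by funext σ; simp [Finset.sum_add_distrib]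

/-- The cocycles in degree `k`. -/
def cocycles (k : ℕ) : AddSubgroup (Cochain S R k) := (coboundary S R k).ker

/-- The coboundaries in degree `k`; there are none but `0` in degree `0`. -/
def coboundaries : (k : ℕ) → AddSubgroup (Cochain S R k)
  | 0 => ⊥
  | k + 1 => (coboundary S R k).range

/-- The `k`-th cohomology group of a simplicial set: cocycles modulo coboundaries. -/
abbrev SCohomology (k : ℕ) : Type (max u v) :=
  cocycles S R k ⧸ (coboundaries S R k).addSubgroupOf (cocycles S R k)

variable {S R}

/-- The front `p`-face `[v₀, …, v_p]` of an `n`-simplex `[v₀, …, v_n]`. -/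
def frontFace (p : ℕ) {n : ℕ} (h : p ≤ n) (σ : Simplices S n) : Simplices S p :=
  S.map (SimplexCategory.subinterval 0 p (by omega)).op σ

/-- The face `[v_p, …, v_{p+q}]` of an `n`-simplex `[v₀, …, v_n]`. -/
def backFace (p q : ℕ) {n : ℕ} (h : p + q ≤ n) (σ : Simplices S n) : Simplices S q :=
  S.map (SimplexCategory.subinterval p q h).op σ

/-- The Alexander–Whitney cup product of cochains,
`(φ ⌣ ψ)(σ) = φ(σ|[v₀, …, v_p]) · ψ(σ|[v_p, …, v_{p+q}])`.
The total degree is a separate variable `n` with `p + q = n`. -/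
def cochainCup {p q n : ℕ} (h : p + q = n) (φ : Cochain S R p) (ψ : Cochain S R q) :
    Cochain S R n :=
  fun σ => φ (frontFace p (by omega) σ) * ψ (backFace p q h.le σ)

lemma coboundary_apply (k : ℕ) (φ : Cochain S R k) (σ : Simplices S (k + 1)) :
    coboundary S R k φ σ = ∑ i : Fin (k + 2), (-1 : ℤ) ^ (i : ℕ) • φ (S.δ i σ) := rfl

/-- `d ∘ d = 0`, so every coboundary is a cocycle. -/
lemma coboundary_coboundary (k : ℕ) (φ : Cochain S R k) :
    coboundary S R (k+1) (coboundary S R k φ) = 0 := by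
  funext σ
  simp only [coboundary_apply, Finset.smul_sum, smul_smul, ← pow_add, Pi.zero_apply]
  rw [← Finset.sum_product']
  refine Finset.sum_involution (fun (p : Fin (k+3) × Fin (k+2)) _ =>
    if h : p.2.castSucc < p.1 then (p.2.castSucc, p.1.pred (Fin.ne_zero_of_lt h))
    else (p.2.succ, ⟨p.1.val, by have := p.2.2; simp [Fin.lt_def] at h; omega⟩)) ?_ ?_ ?_ ?_
  · rintro ⟨i, j⟩ _
    dsimp only
    split_ifs with h
    · have : S.δ j (S.δ i σ) = S.δ (i.pred (Fin.ne_zero_of_lt h)) (S.δ j.castSucc σ) :=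
        SSet.δ_comp_δ'_apply h σ
      rw [this]
      have e : (i : ℕ) = (i.pred (Fin.ne_zero_of_lt h) : ℕ) + 1 := by
        have := Fin.ne_zero_of_lt h
        have : (i:ℕ) ≠ 0 := fun h => this (Fin.ext h)
        simp; omega
      simp only [e, Fin.val_castSucc]
      rw [← add_smul]
      have : (-1:ℤ) ^ ((i.pred (Fin.ne_zero_of_lt h) : ℕ) + 1 + j) + (-1) ^ ((j:ℕ) + (i.pred (Fin.ne_zero_of_lt h) : ℕ)) = 0 := by ring
      rw [this, zero_smul]
    · push Not at h
      have h' : (i:ℕ) ≤ j := h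
      have := SSet.δ_comp_δ_apply (S := S) (i := ⟨i.val, by omega⟩) (j := j) h' σ
      have e : (⟨i.val, by omega⟩ : Fin (k+2)).castSucc = i := rfl
      rw [e] at this
      rw [← this, ← add_smul]
      have : (-1:ℤ) ^ ((i:ℕ) + j) + (-1) ^ ((j.succ:ℕ) + (i : ℕ)) = 0 := by simp; ring
      rw [this, zero_smul]
  · rintro ⟨i, j⟩ _ _
    dsimp only
    split_ifs with h
    · intro e; simp only [Prod.mk.injEq] at e; exact absurd e.1 (ne_of_lt h)
    · intro e; simp only [Prod.mk.injEq] at e; apply h; rw [← e.1]; simp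
  · simp
  · rintro ⟨i, j⟩ _
    by_cases h : j.castSucc < i
    · have h' : ¬ (i.pred (Fin.ne_zero_of_lt h)).castSucc < j.castSucc := by
        simp [Fin.lt_def] at h ⊢; omega
      simp only [h, h', dif_pos, dif_neg, not_false_eq_true]
      ext <;> simp
    · have : (⟨i.val, by have := j.2; simp [Fin.lt_def] at h; omega⟩ : Fin (k+2)).castSucc < j.succ := by
        simp [Fin.lt_def] at h ⊢; omega
      simp only [h, this, dif_pos, dif_neg, not_false_eq_true]
      ext <;> simp

lemma map_map_aux {a b c : SimplexCategory} (f : a ⟶ b) (g : b ⟶ c) (σ : S.obj (op c)) :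
    S.map f.op (S.map g.op σ) = S.map (f ≫ g).op σ := by
  rw [op_comp, S.map_comp]; rfl

lemma subinterval_val {n : ℕ} (j l : ℕ) (h : j + l ≤ n) (x : Fin (l + 1)) :
    ((SimplexCategory.subinterval j l h).toOrderHom x : Fin (n + 1)).val = x.val + j := rfl

lemma delta_val {n : ℕ} (i : Fin (n + 2)) (x : Fin (n + 1)) :
    ((SimplexCategory.δ i).toOrderHom x : Fin (n + 2)).val
      = if x.val < i.val then x.val else x.val + 1 := by
  change (Fin.succAbove i x).val = _
  simp only [Fin.succAbove, Fin.lt_def, Fin.val_castSucc]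
  split_ifs <;> rfl

lemma map_congr_aux {a b : ℕ} (f g : SimplexCategory.mk a ⟶ SimplexCategory.mk b)
    (h : ∀ x : Fin (a + 1), (f.toOrderHom x : Fin (b + 1)).val
      = (g.toOrderHom x : Fin (b + 1)).val) (σ : Simplices S b) :
    S.map f.op σ = S.map g.op σ := by
  have : f = g := by
    ext x
    exact h x
  rw [this]

lemma comp_val {a b c : ℕ} (f : SimplexCategory.mk a ⟶ SimplexCategory.mk b)
    (g : SimplexCategory.mk b ⟶ SimplexCategory.mk c) (x : Fin (a + 1)) :
    ((f ≫ g).toOrderHom x : Fin (c + 1)).val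
      = (g.toOrderHom (f.toOrderHom x : Fin (b + 1)) : Fin (c + 1)).val := rfl

lemma front_delta_le {p n : ℕ} (hp : p ≤ n) (i : Fin (n + 2)) (i' : Fin (p + 2))
    (hi : (i : ℕ) = i') (σ : Simplices S (n + 1)) :
    frontFace p hp (S.δ i σ) = S.δ i' (frontFace (p + 1) (by omega) σ) := by
  simp only [frontFace, SimplicialObject.δ, map_map_aux]
  refine map_congr_aux _ _ (fun x => ?_) σ
  rw [comp_val, comp_val, delta_val, subinterval_val, subinterval_val, delta_val]
  split_ifs <;> omega

lemma front_delta_gt {p n : ℕ} (hp : p ≤ n) (i : Fin (n + 2)) (hi : p < (i : ℕ))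
    (σ : Simplices S (n + 1)) :
    frontFace p hp (S.δ i σ) = frontFace p (by omega) σ := by
  simp only [frontFace, SimplicialObject.δ, map_map_aux]
  refine map_congr_aux _ _ (fun x => ?_) σ
  rw [comp_val, delta_val, subinterval_val, subinterval_val]
  split_ifs <;> omega

lemma back_delta_le {p q n : ℕ} (h : p + q ≤ n) (i : Fin (n + 2)) (hi : (i : ℕ) ≤ p)
    (σ : Simplices S (n + 1)) :
    backFace p q h (S.δ i σ) = backFace (p + 1) q (by omega) σ := by
  simp only [backFace, SimplicialObject.δ, map_map_aux]
  refine map_congr_aux _ _ (fun x => ?_) σ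
  rw [comp_val, delta_val, subinterval_val, subinterval_val]
  split_ifs <;> omega

lemma back_delta_ge {p q n : ℕ} (h : p + q = n) (i : Fin (n + 2)) (k : Fin (q + 2))
    (hi : (i : ℕ) = p + k) (σ : Simplices S (n + 1)) :
    backFace p q h.le (S.δ i σ) = S.δ k (backFace p (q + 1) (by omega) σ) := by
  simp only [backFace, SimplicialObject.δ, map_map_aux]
  refine map_congr_aux _ _ (fun x => ?_) σ
  rw [comp_val, comp_val, delta_val, subinterval_val, subinterval_val, delta_val]
  split_ifs <;> omega

lemma front_last {p n : ℕ} (hp : p + 1 ≤ n) (σ : Simplices S n) :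
    S.δ (Fin.last (p + 1)) (frontFace (p + 1) hp σ) = frontFace p (by omega) σ := by
  simp only [frontFace, SimplicialObject.δ, map_map_aux]
  refine map_congr_aux _ _ (fun x => ?_) σ
  rw [comp_val, subinterval_val, subinterval_val, delta_val]
  simp only [Fin.val_last]
  split_ifs <;> omega

lemma back_zero {p q n : ℕ} (h : p + (q + 1) ≤ n) (σ : Simplices S n) :
    S.δ 0 (backFace p (q + 1) h σ) = backFace (p + 1) q (by omega) σ := by
  simp only [backFace, SimplicialObject.δ, map_map_aux]
  refine map_congr_aux _ _ (fun x => ?_) σ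
  rw [comp_val, subinterval_val, subinterval_val, delta_val]
  rw [if_neg (by simp)]
  omega

/-- The Leibniz rule `d(φ ⌣ ψ) = dφ ⌣ ψ + (-1)ᵖ φ ⌣ dψ`. -/
lemma coboundary_cup {p q n : ℕ} (h : p + q = n) (φ : Cochain S R p) (ψ : Cochain S R q) :
    coboundary S R n (cochainCup h φ ψ)
      = cochainCup (show p + 1 + q = n + 1 by omega) (coboundary S R p φ) ψ
        + (-1 : ℤ) ^ p •
          cochainCup (show p + (q + 1) = n + 1 by omega) φ (coboundary S R q ψ) := by
  funext σ
  have e : p + 1 + (q + 1) = n + 2 := by omega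
  rw [Pi.add_apply, Pi.smul_apply]
  simp only [coboundary_apply, cochainCup, Finset.sum_mul, Finset.mul_sum, smul_mul_assoc,
    mul_smul_comm]
  rw [Fin.sum_univ_castSucc (n := p + 1), Fin.sum_univ_succ (n := q + 1),
    front_last, back_zero, ← (finCongr e).sum_comp, Fin.sum_univ_add, smul_add]
  have hA : ∀ i : Fin (p + 1),
      (-1 : ℤ) ^ ((finCongr e (Fin.castAdd (q + 1) i) : Fin (n + 2)) : ℕ) •
        (φ (frontFace p (by omega) (S.δ (finCongr e (Fin.castAdd (q + 1) i)) σ)) *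
          ψ (backFace p q h.le (S.δ (finCongr e (Fin.castAdd (q + 1) i)) σ)))
      = (-1 : ℤ) ^ (i.castSucc : ℕ) •
        (φ (S.δ i.castSucc (frontFace (p + 1) (by omega) σ)) *
          ψ (backFace (p + 1) q (by omega) σ)) := by
    intro i
    have hi : ((finCongr e (Fin.castAdd (q + 1) i) : Fin (n + 2)) : ℕ) ≤ p := by
      simp; omega
    rw [front_delta_le (n := n) (by omega) (finCongr e (Fin.castAdd (q + 1) i)) i.castSucc rfl,
      back_delta_le _ _ hi]
    rfl
  have hB : ∀ j : Fin (q + 1),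
      (-1 : ℤ) ^ ((finCongr e (Fin.natAdd (p + 1) j) : Fin (n + 2)) : ℕ) •
        (φ (frontFace p (by omega) (S.δ (finCongr e (Fin.natAdd (p + 1) j)) σ)) *
          ψ (backFace p q h.le (S.δ (finCongr e (Fin.natAdd (p + 1) j)) σ)))
      = (-1 : ℤ) ^ p • (-1 : ℤ) ^ (j.succ : ℕ) •
        (φ (frontFace p (by omega) σ) *
          ψ (S.δ j.succ (backFace p (q + 1) (by omega) σ))) := by
    intro j
    have hj : ((finCongr e (Fin.natAdd (p + 1) j) : Fin (n + 2)) : ℕ) = p + j.succ := by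
      simp; omega
    rw [front_delta_gt _ _ (by rw [hj]; simp), back_delta_ge h _ _ hj, hj, pow_add, mul_smul]
  refine (congrArg₂ (· + ·) (Finset.sum_congr rfl fun i _ => hA i)
    (Finset.sum_congr rfl fun j _ => hB j)).trans ?_
  rw [← Finset.smul_sum, Fin.val_last, Fin.val_zero, pow_zero, one_smul, pow_succ, mul_neg_one,
    neg_smul]
  abel

lemma cup_zero_left {p q n : ℕ} (h : p + q = n) (ψ : Cochain S R q) :
    cochainCup h (0 : Cochain S R p) ψ = 0 := by
  funext σ; simp [cochainCup]

lemma cup_zero_right {p q n : ℕ} (h : p + q = n) (φ : Cochain S R p) :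
    cochainCup h φ (0 : Cochain S R q) = 0 := by
  funext σ; simp [cochainCup]

lemma cup_sub_left {p q n : ℕ} (h : p + q = n) (φ φ' : Cochain S R p) (ψ : Cochain S R q) :
    cochainCup h (φ - φ') ψ = cochainCup h φ ψ - cochainCup h φ' ψ := by
  funext σ; simp [cochainCup, sub_mul]

lemma cup_sub_right {p q n : ℕ} (h : p + q = n) (φ : Cochain S R p) (ψ ψ' : Cochain S R q) :
    cochainCup h φ (ψ - ψ') = cochainCup h φ ψ - cochainCup h φ ψ' := by
  funext σ; simp [cochainCup, mul_sub]

lemma cup_mem_cocycles {p q n : ℕ} (h : p + q = n) {φ : Cochain S R p} {ψ : Cochain S R q}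
    (hφ : φ ∈ cocycles S R p) (hψ : ψ ∈ cocycles S R q) :
    cochainCup h φ ψ ∈ cocycles S R n := by
  have hφ' : coboundary S R p φ = 0 := hφ
  have hψ' : coboundary S R q ψ = 0 := hψ
  change coboundary S R n _ = 0
  rw [coboundary_cup, hφ', hψ', cup_zero_left, cup_zero_right, smul_zero, add_zero]

lemma cup_mem_coboundaries_left {p q n : ℕ} (h : p + q = n) {φ : Cochain S R p}
    {ψ : Cochain S R q} (hφ : φ ∈ coboundaries S R p) (hψ : ψ ∈ cocycles S R q) :
    cochainCup h φ ψ ∈ coboundaries S R n := by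
  cases p with
  | zero =>
    have : φ = 0 := hφ
    rw [this, cup_zero_left]
    exact zero_mem _
  | succ p =>
    obtain ⟨η, rfl⟩ := hφ
    obtain rfl : p + q + 1 = n := by omega
    have hψ' : coboundary S R q ψ = 0 := hψ
    refine ⟨cochainCup (n := p + q) rfl η ψ, ?_⟩
    rw [coboundary_cup, hψ', cup_zero_right, smul_zero, add_zero]

lemma cup_mem_coboundaries_right {p q n : ℕ} (h : p + q = n) {φ : Cochain S R p}
    {ψ : Cochain S R q} (hφ : φ ∈ cocycles S R p) (hψ : ψ ∈ coboundaries S R q) :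
    cochainCup h φ ψ ∈ coboundaries S R n := by
  cases q with
  | zero =>
    have : ψ = 0 := hψ
    rw [this, cup_zero_right]
    exact zero_mem _
  | succ q =>
    obtain ⟨η, rfl⟩ := hψ
    obtain rfl : p + q + 1 = n := by omega
    have hφ' : coboundary S R p φ = 0 := hφ
    refine ⟨(-1 : ℤ) ^ p • cochainCup (n := p + q) rfl φ η, ?_⟩
    rw [map_zsmul, coboundary_cup, hφ', cup_zero_left, zero_add, smul_smul, ← mul_pow]
    simp

/-- The cup product `Hᵖ × H^q → H^{p+q}`, induced by the cup product of cocycles. -/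
def cup {p q : ℕ} (a : SCohomology S R p) (b : SCohomology S R q) :
    SCohomology S R (p + q) :=
  Quotient.map₂
    (fun φ ψ => ⟨cochainCup rfl φ.1 ψ.1, cup_mem_cocycles rfl φ.2 ψ.2⟩)
    (by
      intro φ φ' hφ ψ ψ' hψ
      rw [← Quotient.eq_iff_equiv] at hφ hψ ⊢
      have hφ := QuotientAddGroup.eq.1 hφ
      have hψ := QuotientAddGroup.eq.1 hψ
      refine QuotientAddGroup.eq.2 ?_
      rw [AddSubgroup.mem_addSubgroupOf] at hφ hψ ⊢
      have e : cochainCup (n := p + q) rfl (-φ.1 + φ'.1) ψ.1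
            + cochainCup rfl φ'.1 (-ψ.1 + ψ'.1)
          = -cochainCup rfl φ.1 ψ.1 + cochainCup rfl φ'.1 ψ'.1 := by
        rw [neg_add_eq_sub, neg_add_eq_sub, cup_sub_left, cup_sub_right]
        abel
      change -cochainCup rfl φ.1 ψ.1 + cochainCup rfl φ'.1 ψ'.1 ∈ coboundaries S R (p + q)
      rw [← e]
      exact add_mem (cup_mem_coboundaries_left rfl hφ ψ.2)
        (cup_mem_coboundaries_right rfl φ'.2 hψ)) a b

variable (S R) in
/-- The unit class `1 ∈ H⁰`, represented by the constant cochain `1`. -/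
def unitClass : SCohomology S R 0 :=
  QuotientAddGroup.mk ⟨fun _ => 1, by
    change coboundary S R 0 _ = 0
    funext σ
    simp [coboundary_apply, Fin.sum_univ_two]⟩

/-- The cup product `α₁ ⌣ (α₂ ⌣ ⋯ (α_n ⌣ 1))` of a list of classes, each given together with
its degree; the result comes with its degree `k₁ + (k₂ + ⋯ (k_n + 0))`. -/
def cupProd : List (Σ k, SCohomology S R k) → Σ k, SCohomology S R k
  | [] => ⟨0, unitClass S R⟩
  | a :: l => ⟨a.1 + (cupProd l).1, cup a.2 (cupProd l).2⟩

variable (R) in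
/-- Pull-back of cochains along a simplicial map. -/
def cochainPullback {T : SSet.{u}} (f : S ⟶ T) (k : ℕ) : Cochain T R k →+ Cochain S R k where
  toFun φ := fun σ => φ (f.app (op (SimplexCategory.mk k)) σ)
  map_zero' := rfl
  map_add' _ _ := rfl

lemma coboundary_pullback {T : SSet.{u}} (f : S ⟶ T) (k : ℕ) (φ : Cochain T R k) :
    coboundary S R k (cochainPullback R f k φ)
      = cochainPullback R f (k + 1) (coboundary T R k φ) := by
  funext σ
  have : ∀ i : Fin (k + 2), f.app (op (SimplexCategory.mk k)) (S.δ i σ) = T.δ i (f.app (op (SimplexCategory.mk (k + 1))) σ) :=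
    fun i => ConcreteCategory.congr_hom (f.naturality (SimplexCategory.δ i).op) σ
  simp [coboundary_apply, cochainPullback, this]

variable (R) in
/-- The homomorphism `f^* : Hᵏ(T; R) → Hᵏ(S; R)` induced by a simplicial map `f : S ⟶ T`. -/
def pullback {T : SSet.{u}} (f : S ⟶ T) (k : ℕ) : SCohomology T R k →+ SCohomology S R k :=
  QuotientAddGroup.map _ _
    (((cochainPullback R f k).comp (cocycles T R k).subtype).codRestrict (cocycles S R k)
      (by
        rintro ⟨φ, hφ⟩
        have hφ' : coboundary T R k φ = 0 := hφ
        change coboundary S R k (cochainPullback R f k φ) = 0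
        rw [coboundary_pullback, hφ', map_zero]))
    (by
      rintro ⟨φ, hφ⟩ h
      rw [AddSubgroup.mem_addSubgroupOf] at h
      change cochainPullback R f k φ ∈ coboundaries S R k
      change φ ∈ coboundaries T R k at h
      cases k with
      | zero =>
        have : φ = 0 := h
        rw [this, map_zero]
        exact zero_mem _
      | succ k =>
        obtain ⟨η, rfl⟩ := h
        exact ⟨cochainPullback R f k η, coboundary_pullback f k η⟩)

end Cohomology

/-- The singular cohomology group `Hᵏ(X; R)`. -/
abbrev SingularCohomology (k : ℕ) (X : Type u) [TopologicalSpace X] (R : Type v) [Ring R] :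
    Type (max u v) :=
  SCohomology (TopCat.toSSet.obj (TopCat.of X)) R k

/-- The homomorphism `f^* : Hᵏ(Y; R) → Hᵏ(X; R)` induced by a continuous map `f : X → Y`. -/
def singularPullback {X Y : Type u} [TopologicalSpace X] [TopologicalSpace Y]
    (R : Type v) [Ring R] (f : C(X, Y)) (k : ℕ) :
    SingularCohomology k Y R →+ SingularCohomology k X R :=
  pullback R (TopCat.toSSet.map (TopCat.ofHom f)) k

/-! ## Symmetric powers -/

/-- Two `m`-tuples are equivalent if they differ by a permutation of the coordinates. -/
def symSetoid (m : ℕ) (X : Type u) : Setoid (Fin m → X) where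
  r x y := ∃ s : Equiv.Perm (Fin m), y = x ∘ s
  iseqv :=
    { refl := fun x => ⟨1, rfl⟩
      symm := by
        rintro x y ⟨s, rfl⟩
        exact ⟨s⁻¹, by funext i; simp⟩
      trans := by
        rintro x y z ⟨s, rfl⟩ ⟨t, rfl⟩
        exact ⟨s * t, rfl⟩ }

/-- The symmetric power `SPᵐ(X) = Xᵐ / S_m`. -/
def SymPower (m : ℕ) (X : Type u) : Type u := Quotient (symSetoid m X)

/-- `SPᵐ(X)` carries the quotient topology of the product topology on `Xᵐ`. -/
instance (m : ℕ) (X : Type u) [TopologicalSpace X] : TopologicalSpace (SymPower m X) :=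
  inferInstanceAs (TopologicalSpace (Quotient (symSetoid m X)))

/-- The diagonal map `δ_m : X → SPᵐ(X)`, `x ↦ [x, …, x]`. -/
def symDiagonal (m : ℕ) (X : Type u) [TopologicalSpace X] : C(X, SymPower m X) where
  toFun x := Quotient.mk (symSetoid m X) (fun _ => x)
  continuous_toFun := continuous_quotient_mk'.comp (continuous_pi fun _ => continuous_id)

/-! ## Absolute neighbourhood retracts -/

/-- A metric space `X` is an absolute neighbourhood retract (for metric spaces) if, whenever `X`
is embedded as a closed subset of a metric space `Y`, some neighbourhood of `X` in `Y` retracts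
onto `X`. -/
def IsANR (X : Type u) [MetricSpace X] : Prop :=
  ∀ (Y : Type u) [MetricSpace Y] (e : X → Y), Topology.IsClosedEmbedding e →
    ∃ U : Set Y, IsOpen U ∧ Set.range e ⊆ U ∧
      ∃ r : Y → X, ContinuousOn r U ∧ ∀ x, r (e x) = x

/-! ## Distributional LS-category -/

/-- The path space `P(X)` of all continuous maps `[0,1] → X`, with the metric of uniform
convergence (which induces the compact-open topology). -/
abbrev PathSpace (X : Type u) [MetricSpace X] : Type u := C(unitInterval, X)

instance (X : Type u) [MetricSpace X] : MeasurableSpace (PathSpace X) := borel _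

instance (X : Type u) [MetricSpace X] : BorelSpace (PathSpace X) := ⟨rfl⟩

/-- The space `𝓑_k(Z)` of probability measures on a metric space `Z` (with its Borel sets)
supported by at most `k` points, with the Lévy–Prokhorov metric. -/
def FinMeasures (k : ℕ) (Z : Type u) [MetricSpace Z] [MeasurableSpace Z] [BorelSpace Z] :
    Type u :=
  {μ : LevyProkhorov (ProbabilityMeasure Z) //
    ∃ F : Finset Z, F.card ≤ k ∧ (μ.toMeasure : Measure Z) (F : Set Z)ᶜ = 0}

instance (k : ℕ) (Z : Type u) [MetricSpace Z] [MeasurableSpace Z] [BorelSpace Z] :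
    MetricSpace (FinMeasures k Z) :=
  inferInstanceAs (MetricSpace {μ : LevyProkhorov (ProbabilityMeasure Z) //
    ∃ F : Finset Z, F.card ≤ k ∧ (μ.toMeasure : Measure Z) (F : Set Z)ᶜ = 0})

/-- The support of a finitely supported measure: the set of its atoms. -/
def FinMeasures.supp {k : ℕ} {Z : Type u} [MetricSpace Z] [MeasurableSpace Z] [BorelSpace Z]
    (μ : FinMeasures k Z) : Set Z :=
  {z | (μ.1.toMeasure : Measure Z) {z} ≠ 0}

/-- A `k`-distributed homotopy between `f` and `g`: a continuous map `H : Y → 𝓑_k(P(X))` such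
that every path in the support of `H y` runs from `f y` to `g y`. -/
structure DistHomotopy (k : ℕ) {Y : Type v} {X : Type u} [TopologicalSpace Y] [MetricSpace X]
    (f g : C(Y, X)) where
  /-- The underlying continuous map. -/
  toMap : C(Y, FinMeasures k (PathSpace X))
  /-- The supporting paths have the prescribed end points. -/
  endpoints : ∀ (y : Y) (φ : PathSpace X), φ ∈ (toMap y).supp → φ 0 = f y ∧ φ 1 = g y

/-- `X` is `k`-contractible: there is a `k`-distributed homotopy between the identity of `X`
and a constant map. -/
def IsDistContractible (k : ℕ) (X : Type u) [MetricSpace X] : Prop :=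
  ∃ x₀ : X, Nonempty (DistHomotopy k (ContinuousMap.id X) (ContinuousMap.const X x₀))

/-- The distributional LS-category: the least `k` such that `X` is `(k+1)`-contractible, and
`∞` if there is no such `k`. -/
def dcat (X : Type u) [MetricSpace X] : ℕ∞ :=
  ⨅ (k : ℕ) (_ : IsDistContractible (k + 1) X), (k : ℕ∞)

end DCat

end

noncomputable section

namespace DCat


/-! Suppose a distributed contraction `H` has supports of size at most `n`. Let `A_i` be the set of
points `x` at which `H x` has exactly `i` atoms; `A_1, …, A_n` cover `X`. Nearby measures have atoms
near every atom of a given one, so where the number of atoms is constant the support moves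
continuously as an unordered configuration of `i` distinct paths
(`FinMeasures.eventually_exists_perm`). Following these paths from `x` to `x₀` contracts the
diagonal of `SP^i(X)` over `A_i`.

The sets `A_i` need not be open, so the contraction is extended to an open `U_i ⊇ A_i`
(`exists_open_homotopy_symPower`). The space `X` is embedded as a closed subset of a normed space,
where configurations at nearby points of `A_i` are matched and averaged with a partition of unity.
The averages are corrected to start at the right point and then retracted to `X` by the ANR
property. Matchings exist only up to a permutation, which is why the target is a symmetric power. As
`i` divides `n!`, repeating coordinates turns the result into a null-homotopy of `δ_{n!}` on `U_i`.

In cohomology, a null-homotopy on `U_i` gives each `α_i` a representative vanishing on the simplices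
in `U_i` (`hasRepVanishingOn_singularPullback`, by a cone construction). The cup product of these
cocycles vanishes on every simplex lying in some `U_i`. Barycentric subdivision shows that such a
cocycle of positive degree is a coboundary (`mem_coboundaries_of_vanishesOn`), contradicting the
nonvanishing of the product. -/

/-! ## Chains of tuples, cones and formal barycentric subdivision -/

section Tuples

/-- Formal integral combinations of `k`-tuples of points of `K`. The tuple of length `0` is
included, so that these groups form the augmented ordered chain complex of `K`. -/
abbrev TupleChain (K : Type*) (k : ℕ) : Type _ := FreeAbelianGroup (Fin k → K)

variable {K L : Type*}

/-- The boundary of a chain of tuples. -/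
def tupleBoundary (K : Type*) (k : ℕ) : TupleChain K (k + 1) →+ TupleChain K k :=
  FreeAbelianGroup.lift fun v =>
    ∑ i : Fin (k + 1), (-1 : ℤ) ^ (i : ℕ) • FreeAbelianGroup.of (v ∘ i.succAbove)

/-- The cone over a chain of tuples with apex `p`. -/
def tupleCone (p : K) (k : ℕ) : TupleChain K k →+ TupleChain K (k + 1) :=
  FreeAbelianGroup.map fun v => Fin.cons p v

/-- The pushforward of chains of tuples along a map. -/
def tupleMap (f : K → L) (k : ℕ) : TupleChain K k →+ TupleChain L k :=
  FreeAbelianGroup.map fun v => f ∘ v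

lemma tupleBoundary_of (k : ℕ) (v : Fin (k + 1) → K) :
    tupleBoundary K k (.of v)
      = ∑ i : Fin (k + 1), (-1 : ℤ) ^ (i : ℕ) • FreeAbelianGroup.of (v ∘ i.succAbove) :=
  FreeAbelianGroup.lift_apply_of _ _

lemma tupleCone_of (p : K) (k : ℕ) (v : Fin k → K) :
    tupleCone p k (.of v) = .of (Fin.cons p v) :=
  FreeAbelianGroup.map_of_apply _

lemma tupleMap_of (f : K → L) (k : ℕ) (v : Fin k → K) :
    tupleMap f k (.of v) = .of (f ∘ v) :=
  FreeAbelianGroup.map_of_apply _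

/-- Omitting the apex returns the base; omitting any other entry gives the cone over a face, with
the sign shifted by one. The later chain identities all follow from this formula by induction. -/
lemma tupleBoundary_cone (p : K) (k : ℕ) (c : TupleChain K (k + 1)) :
    tupleBoundary K (k + 1) (tupleCone p (k + 1) c)
      = c - tupleCone p k (tupleBoundary K k c) := by
  suffices h : (tupleBoundary K (k + 1)).comp (tupleCone p (k + 1))
      = AddMonoidHom.id _ - (tupleCone p k).comp (tupleBoundary K k) from DFunLike.congr_fun h c
  refine FreeAbelianGroup.lift_ext _ _ fun v => ?_
  simp only [AddMonoidHom.comp_apply, AddMonoidHom.sub_apply, AddMonoidHom.id_apply, tupleCone_of,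
    tupleBoundary_of, map_sum, map_zsmul]
  rw [Fin.sum_univ_succ]
  have h0 : (Fin.cons p v : Fin (k + 2) → K) ∘ (0 : Fin (k + 2)).succAbove = v := by
    funext j; simp
  have h1 : ∀ i : Fin (k + 1), (Fin.cons p v : Fin (k + 2) → K) ∘ i.succ.succAbove
      = Fin.cons p (v ∘ i.succAbove) := by
    intro i; funext j
    refine Fin.cases ?_ (fun j => ?_) j <;> simp
  simp only [h0, h1, Fin.val_zero, pow_zero, one_smul, Fin.val_succ, pow_succ, mul_neg, mul_one,
    neg_smul, Finset.sum_neg_distrib]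
  abel

lemma tupleBoundary_cone_zero (p : K) (c : TupleChain K 0) :
    tupleBoundary K 0 (tupleCone p 0 c) = c := by
  suffices h : (tupleBoundary K 0).comp (tupleCone p 0) = AddMonoidHom.id _ from
    DFunLike.congr_fun h c
  refine FreeAbelianGroup.lift_ext _ _ fun v => ?_
  simp only [AddMonoidHom.comp_apply, AddMonoidHom.id_apply, tupleCone_of, tupleBoundary_of]
  rw [Fin.sum_univ_one, Fin.val_zero, pow_zero, one_smul]
  congr 1

/-- Every nonempty tuple is the cone over its tail, so the cone formula and induction replace the
usual cancellation of signs. -/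
lemma tupleBoundary_boundary (k : ℕ) (c : TupleChain K (k + 2)) :
    tupleBoundary K k (tupleBoundary K (k + 1) c) = 0 := by
  suffices h : (tupleBoundary K k).comp (tupleBoundary K (k + 1)) = 0 from DFunLike.congr_fun h c
  clear c
  induction k with
  | zero =>
    refine FreeAbelianGroup.lift_ext _ _ fun v => ?_
    rw [AddMonoidHom.comp_apply, AddMonoidHom.zero_apply, ← Fin.cons_self_tail v, ← tupleCone_of,
      tupleBoundary_cone, map_sub, tupleBoundary_cone_zero, sub_self]
  | succ k ih =>
    refine FreeAbelianGroup.lift_ext _ _ fun v => ?_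
    have := DFunLike.congr_fun ih (.of (Fin.tail v))
    rw [AddMonoidHom.comp_apply, AddMonoidHom.zero_apply] at this
    rw [AddMonoidHom.comp_apply, AddMonoidHom.zero_apply, ← Fin.cons_self_tail v, ← tupleCone_of,
      tupleBoundary_cone, map_sub, tupleBoundary_cone, this, map_zero, sub_zero, sub_self]

lemma tupleMap_boundary (f : K → L) (k : ℕ) (c : TupleChain K (k + 1)) :
    tupleMap f k (tupleBoundary K k c) = tupleBoundary L k (tupleMap f (k + 1) c) := by
  suffices h : (tupleMap f k).comp (tupleBoundary K k)
      = (tupleBoundary L k).comp (tupleMap f (k + 1)) from DFunLike.congr_fun h c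
  refine FreeAbelianGroup.lift_ext _ _ fun v => ?_
  simp only [AddMonoidHom.comp_apply, tupleMap_of, tupleBoundary_of, map_sum, map_zsmul]
  rfl

lemma tupleMap_cone (f : K → L) (p : K) (k : ℕ) (c : TupleChain K k) :
    tupleMap f (k + 1) (tupleCone p k c) = tupleCone (f p) k (tupleMap f k c) := by
  suffices h : (tupleMap f (k + 1)).comp (tupleCone p k)
      = (tupleCone (f p) k).comp (tupleMap f k) from DFunLike.congr_fun h c
  refine FreeAbelianGroup.lift_ext _ _ fun v => ?_
  simp only [AddMonoidHom.comp_apply, tupleMap_of, tupleCone_of, Fin.comp_cons]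

variable (b : ∀ k : ℕ, (Fin (k + 1) → K) → K) (b' : ∀ k : ℕ, (Fin (k + 1) → L) → L)

/-- The subdivision operator on chains of tuples determined by a choice `b` of a point for each
non-empty tuple. -/
def tupleSubdiv : ∀ k : ℕ, TupleChain K k →+ TupleChain K k
  | 0 => AddMonoidHom.id _
  | k + 1 => FreeAbelianGroup.lift fun v =>
      tupleCone (b k v) k (tupleSubdiv k (tupleBoundary K k (.of v)))

/-- The chain homotopy between the identity and the subdivision operator. -/
def tupleHomotopy : ∀ k : ℕ, TupleChain K k →+ TupleChain K (k + 1)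
  | 0 => 0
  | k + 1 => FreeAbelianGroup.lift fun v =>
      tupleCone (b k v) (k + 1) (.of v - tupleHomotopy k (tupleBoundary K k (.of v)))

lemma tupleSubdiv_of (k : ℕ) (v : Fin (k + 1) → K) :
    tupleSubdiv b (k + 1) (.of v)
      = tupleCone (b k v) k (tupleSubdiv b k (tupleBoundary K k (.of v))) :=
  FreeAbelianGroup.lift_apply_of _ _

lemma tupleHomotopy_of (k : ℕ) (v : Fin (k + 1) → K) :
    tupleHomotopy b (k + 1) (.of v)
      = tupleCone (b k v) (k + 1) (.of v - tupleHomotopy b k (tupleBoundary K k (.of v))) :=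
  FreeAbelianGroup.lift_apply_of _ _

lemma tupleBoundary_subdiv (k : ℕ) (c : TupleChain K (k + 1)) :
    tupleBoundary K k (tupleSubdiv b (k + 1) c) = tupleSubdiv b k (tupleBoundary K k c) := by
  suffices h : (tupleBoundary K k).comp (tupleSubdiv b (k + 1))
      = (tupleSubdiv b k).comp (tupleBoundary K k) from DFunLike.congr_fun h c
  clear c
  induction k with
  | zero =>
    refine FreeAbelianGroup.lift_ext _ _ fun v => ?_
    rw [AddMonoidHom.comp_apply, AddMonoidHom.comp_apply, tupleSubdiv_of, tupleBoundary_cone_zero]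
  | succ k ih =>
    refine FreeAbelianGroup.lift_ext _ _ fun v => ?_
    have := DFunLike.congr_fun ih (tupleBoundary K (k + 1) (.of v))
    rw [AddMonoidHom.comp_apply, AddMonoidHom.comp_apply, tupleBoundary_boundary, map_zero] at this
    rw [AddMonoidHom.comp_apply, AddMonoidHom.comp_apply, tupleSubdiv_of, tupleBoundary_cone, this,
      map_zero, sub_zero]

/-- The chain coned off in `tupleHomotopy` has, by induction and `∂∂ = 0`, boundary equal to the
subdivision of `∂v`. Its cone is by definition the subdivision of `v`, which is the correction term
in the cone formula. -/
lemma tupleBoundary_homotopy (k : ℕ) (c : TupleChain K (k + 1)) :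
    tupleBoundary K (k + 1) (tupleHomotopy b (k + 1) c)
      = c - tupleSubdiv b (k + 1) c - tupleHomotopy b k (tupleBoundary K k c) := by
  suffices h : (tupleBoundary K (k + 1)).comp (tupleHomotopy b (k + 1))
      = AddMonoidHom.id _ - tupleSubdiv b (k + 1) - (tupleHomotopy b k).comp (tupleBoundary K k)
    from DFunLike.congr_fun h c
  clear c
  induction k with
  | zero =>
    refine FreeAbelianGroup.lift_ext _ _ fun v => ?_
    simp only [AddMonoidHom.comp_apply, AddMonoidHom.sub_apply, AddMonoidHom.id_apply,
      tupleHomotopy_of, tupleBoundary_cone, tupleSubdiv_of]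
    simp [tupleHomotopy, tupleSubdiv]
  | succ k ih =>
    refine FreeAbelianGroup.lift_ext _ _ fun v => ?_
    have := DFunLike.congr_fun ih (tupleBoundary K (k + 1) (.of v))
    simp only [AddMonoidHom.comp_apply, AddMonoidHom.sub_apply, AddMonoidHom.id_apply,
      tupleBoundary_boundary, map_zero, sub_zero] at this
    simp only [AddMonoidHom.comp_apply, AddMonoidHom.sub_apply, AddMonoidHom.id_apply]
    rw [tupleHomotopy_of, tupleBoundary_cone, map_sub (tupleBoundary K (k + 1)), this,
      tupleSubdiv_of, sub_sub_cancel]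
    abel

variable {b b'}

/-- Affine maps preserve barycenters, so this applies to the face inclusions of a simplex and makes
subdivision natural in singular simplices. -/
lemma tupleMap_subdiv {f : K → L} (hf : ∀ k v, f (b k v) = b' k (f ∘ v)) (k : ℕ)
    (c : TupleChain K k) :
    tupleMap f k (tupleSubdiv b k c) = tupleSubdiv b' k (tupleMap f k c) := by
  suffices h : (tupleMap f k).comp (tupleSubdiv b k)
      = (tupleSubdiv b' k).comp (tupleMap f k) from DFunLike.congr_fun h c
  clear c
  induction k with
  | zero => rfl
  | succ k ih =>
    refine FreeAbelianGroup.lift_ext _ _ fun v => ?_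
    have := DFunLike.congr_fun ih (tupleBoundary K k (.of v))
    rw [AddMonoidHom.comp_apply, AddMonoidHom.comp_apply, tupleMap_boundary, tupleMap_of] at this
    rw [AddMonoidHom.comp_apply, AddMonoidHom.comp_apply, tupleSubdiv_of, tupleMap_of,
      tupleSubdiv_of, tupleMap_cone, hf, this]

lemma tupleMap_homotopy {f : K → L} (hf : ∀ k v, f (b k v) = b' k (f ∘ v)) (k : ℕ)
    (c : TupleChain K k) :
    tupleMap f (k + 1) (tupleHomotopy b k c) = tupleHomotopy b' k (tupleMap f k c) := by
  suffices h : (tupleMap f (k + 1)).comp (tupleHomotopy b k)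
      = (tupleHomotopy b' k).comp (tupleMap f k) from DFunLike.congr_fun h c
  clear c
  induction k with
  | zero => refine FreeAbelianGroup.lift_ext _ _ fun v => ?_; simp [tupleHomotopy]
  | succ k ih =>
    refine FreeAbelianGroup.lift_ext _ _ fun v => ?_
    have := DFunLike.congr_fun ih (tupleBoundary K k (.of v))
    rw [AddMonoidHom.comp_apply, AddMonoidHom.comp_apply, tupleMap_boundary, tupleMap_of] at this
    rw [AddMonoidHom.comp_apply, AddMonoidHom.comp_apply, tupleHomotopy_of, tupleMap_of,
      tupleHomotopy_of, tupleMap_cone, hf, map_sub, tupleMap_of, this]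

/-- The chains all of whose tuples satisfy `P`. -/
def tupleSpan {k : ℕ} (P : Set (Fin k → K)) : AddSubgroup (TupleChain K k) :=
  AddSubgroup.closure (FreeAbelianGroup.of '' P)

lemma of_mem_tupleSpan {k : ℕ} {P : Set (Fin k → K)} {v : Fin k → K} (hv : v ∈ P) :
    FreeAbelianGroup.of v ∈ tupleSpan P :=
  AddSubgroup.subset_closure ⟨v, hv, rfl⟩

lemma map_mem_of_mem_tupleSpan {k : ℕ} {A : Type*} [AddCommGroup A] {P : Set (Fin k → K)}
    {G : AddSubgroup A} (g : TupleChain K k →+ A) (h : ∀ v ∈ P, g (.of v) ∈ G)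
    {c : TupleChain K k} (hc : c ∈ tupleSpan P) : g c ∈ G := by
  have : tupleSpan P ≤ G.comap g := by
    rw [tupleSpan, AddSubgroup.closure_le]
    rintro _ ⟨v, hv, rfl⟩
    exact h v hv
  exact this hc

lemma tupleCone_mem_tupleSpan {k : ℕ} {P : Set (Fin k → K)} {Q : Set (Fin (k + 1) → K)} {p : K}
    (h : ∀ v ∈ P, (Fin.cons p v : Fin (k + 1) → K) ∈ Q) {c : TupleChain K k}
    (hc : c ∈ tupleSpan P) : tupleCone p k c ∈ tupleSpan Q :=
  map_mem_of_mem_tupleSpan _ (fun v hv => by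
    rw [tupleCone_of]; exact of_mem_tupleSpan (h v hv)) hc

lemma tupleBoundary_of_mem_tupleSpan {k : ℕ} {P : Set (Fin k → K)} {v : Fin (k + 1) → K}
    (h : ∀ i : Fin (k + 1), v ∘ i.succAbove ∈ P) :
    tupleBoundary K k (.of v) ∈ tupleSpan P := by
  rw [tupleBoundary_of]
  exact sum_mem fun i _ => zsmul_mem (of_mem_tupleSpan (h i)) _

/-- The homotopy does not leave a class of points that contains `b` of each of its tuples. -/
lemma tupleHomotopy_mem_of_range {C : Set K} (hC : ∀ k v, (∀ j, v j ∈ C) → b k v ∈ C) (k : ℕ)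
    {c : TupleChain K k} (hc : c ∈ tupleSpan {v | ∀ j, v j ∈ C}) :
    tupleHomotopy b k c ∈ tupleSpan {v | ∀ j, v j ∈ C} := by
  induction k with
  | zero => exact zero_mem _
  | succ k ih =>
    refine map_mem_of_mem_tupleSpan _ (fun v hv => ?_) hc
    rw [tupleHomotopy_of]
    exact tupleCone_mem_tupleSpan (fun w hw j => by
      refine Fin.cases ?_ (fun j => ?_) j
      exacts [hC k v hv, hw j])
      (sub_mem (of_mem_tupleSpan hv) (ih (tupleBoundary_of_mem_tupleSpan fun i j => hv _)))

end Tuples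

/-! ## Affine simplices in a standard simplex -/

section Affine

variable {ι κ : Type*} [Fintype ι] [Fintype κ]

/-- The point with barycentric coordinates `t` with respect to the points `w j`. -/
def affineComb {k : ℕ} (w : Fin k → stdSimplex ℝ ι) (t : stdSimplex ℝ (Fin k)) :
    stdSimplex ℝ ι :=
  ⟨∑ j, t j • (w j : ι → ℝ), (convex_stdSimplex ℝ ι).sum_mem (fun j _ => t.2.1 j) t.2.2
    fun j _ => (w j).2⟩

lemma affineComb_val {k : ℕ} (w : Fin k → stdSimplex ℝ ι) (t : stdSimplex ℝ (Fin k)) :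
    (affineComb w t).1 = ∑ j, t j • (w j).1 := rfl

lemma continuous_affineComb {k : ℕ} (w : Fin k → stdSimplex ℝ ι) : Continuous (affineComb w) := by
  refine Continuous.subtype_mk (continuous_finsetSum _ fun j _ => ?_) _
  exact ((continuous_apply j).comp continuous_subtype_val).smul continuous_const

lemma affineComb_map {k l : ℕ} (w : Fin k → stdSimplex ℝ ι) (f : Fin l → Fin k)
    (t : stdSimplex ℝ (Fin l)) : affineComb w (stdSimplex.map f t) = affineComb (w ∘ f) t := by
  refine Subtype.ext ?_
  simp only [affineComb_val, stdSimplex.map_coe, FunOnFinite.linearMap_apply_apply, Finset.sum_smul]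
  rw [← Finset.sum_fiberwise Finset.univ f]
  refine Finset.sum_congr rfl fun j _ => Finset.sum_congr rfl fun i hi => ?_
  rw [Function.comp_apply, (Finset.mem_filter.1 hi).2]

lemma map_affineComb {k : ℕ} (w : Fin k → stdSimplex ℝ ι) (f : ι → κ)
    (t : stdSimplex ℝ (Fin k)) :
    stdSimplex.map f (affineComb w t) = affineComb (fun j => stdSimplex.map f (w j)) t := by
  refine Subtype.ext ?_
  change FunOnFinite.linearMap ℝ ℝ f (∑ j, t j • (w j).1) = _
  rw [map_sum]
  simp only [map_smul]
  rfl

lemma affineComb_vertex {k : ℕ} [DecidableEq (Fin k)] (t : stdSimplex ℝ (Fin k)) :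
    affineComb (fun j => stdSimplex.vertex j) t = t := by
  refine Subtype.ext ?_
  funext i
  simp [affineComb_val, Finset.sum_apply, Pi.single_apply]
  rfl

lemma affineComb_mem {C : Set (ι → ℝ)} (hC : Convex ℝ C) {k : ℕ} {w : Fin k → stdSimplex ℝ ι}
    (hw : ∀ j, (w j).1 ∈ C) (t : stdSimplex ℝ (Fin k)) : (affineComb w t).1 ∈ C :=
  hC.sum_mem (fun j _ => t.2.1 j) t.2.2 fun j _ => hw j

/-- The barycenter of a non-empty tuple. -/
def tupleBarycenter (k : ℕ) (v : Fin (k + 1) → stdSimplex ℝ ι) : stdSimplex ℝ ι :=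
  affineComb v stdSimplex.barycenter

lemma affineComb_mem_closedBall {k : ℕ} {w : Fin k → stdSimplex ℝ ι} {p : stdSimplex ℝ ι} {D : ℝ}
    (hw : ∀ j, w j ∈ Metric.closedBall p D) (t : stdSimplex ℝ (Fin k)) :
    affineComb w t ∈ Metric.closedBall p D :=
  affineComb_mem (convex_closedBall p.1 D) hw t

/-- The difference is the average of the `k + 1` vectors `v i - v j`, of which the one with `j = i`
is zero. This gives the factor `k / (k + 1)`, enlarged to one that is uniform for `k ≤ N`. -/
lemma dist_tupleBarycenter_le {N k : ℕ} (hk : k ≤ N) {v : Fin (k + 1) → stdSimplex ℝ ι} {D : ℝ}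
    (hv : ∀ i j, dist (v i) (v j) ≤ D) (i : Fin (k + 1)) :
    dist (v i) (tupleBarycenter k v) ≤ (N / (N + 1) : ℝ) * D := by
  have hD : 0 ≤ D := dist_nonneg.trans (hv i i)
  have h1 : (v i).1 - (tupleBarycenter k v).1
      = ∑ j ∈ Finset.univ.erase i, ((k : ℝ) + 1)⁻¹ • ((v i).1 - (v j).1) := by
    rw [Finset.sum_erase _ (by simp)]
    simp only [smul_sub, Finset.sum_sub_distrib, Finset.sum_const, Finset.card_univ,
      Fintype.card_fin, tupleBarycenter, affineComb_val]
    congr 1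
    · rw [← Nat.cast_smul_eq_nsmul ℝ, smul_smul]
      push_cast
      rw [mul_inv_cancel₀ (by positivity), one_smul]
    · refine Finset.sum_congr rfl fun j _ => ?_
      have : (stdSimplex.barycenter : stdSimplex ℝ (Fin (k + 1))) j = ((k : ℝ) + 1)⁻¹ := by
        change (Fintype.card (Fin (k + 1)) : ℝ)⁻¹ = _
        simp
      rw [this]
  change dist (v i).1 (tupleBarycenter k v).1 ≤ _
  rw [dist_eq_norm, h1]
  refine (norm_sum_le_of_le _ (f := fun j => ((k : ℝ) + 1)⁻¹ • ((v i).1 - (v j).1))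
    (n := fun _ => ((k : ℝ) + 1)⁻¹ * D) fun j _ => ?_).trans ?_
  · rw [norm_smul, Real.norm_of_nonneg (by positivity), ← dist_eq_norm]
    exact mul_le_mul_of_nonneg_left (hv i j) (by positivity)
  · rw [Finset.sum_const, Finset.card_erase_of_mem (Finset.mem_univ _), Finset.card_univ,
      Fintype.card_fin, Nat.add_sub_cancel, nsmul_eq_mul, ← mul_assoc]
    refine mul_le_mul_of_nonneg_right ?_ hD
    rw [← div_eq_mul_inv, div_le_div_iff₀ (by positivity) (by positivity)]
    have : (k : ℝ) ≤ N := by exact_mod_cast hk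
    nlinarith

/-- Barycentric subdivision contracts the mesh. -/
lemma tupleSubdiv_mem_mesh {N : ℕ} {D : ℝ} {C : Set (stdSimplex ℝ ι)}
    (hC : ∀ k v, (∀ j, v j ∈ C) → tupleBarycenter k v ∈ C) (k : ℕ) (hk : k ≤ N + 1)
    {c : TupleChain (stdSimplex ℝ ι) k}
    (hc : c ∈ tupleSpan {v | (∀ j, v j ∈ C) ∧ ∀ i j, dist (v i) (v j) ≤ D}) :
    tupleSubdiv tupleBarycenter k c
      ∈ tupleSpan {v | (∀ j, v j ∈ C) ∧ ∀ i j, dist (v i) (v j) ≤ (N / (N + 1) : ℝ) * D} := by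
  induction k generalizing C with
  | zero =>
    refine map_mem_of_mem_tupleSpan _ (fun v hv => ?_) hc
    exact of_mem_tupleSpan ⟨hv.1, fun i => i.elim0⟩
  | succ k ih =>
    refine map_mem_of_mem_tupleSpan _ (fun v hv => ?_) hc
    rw [tupleSubdiv_of]
    have hD : 0 ≤ D := dist_nonneg.trans (hv.2 0 0)
    have hq : 0 ≤ (N / (N + 1) : ℝ) * D := by positivity
    have hb := dist_tupleBarycenter_le (Nat.le_of_succ_le_succ hk) hv.2
    -- The induction runs over a shrinking region `C`: the subdivided faces stay in the ball about
    -- the barycenter, because balls are convex, so the new edges to the apex are short as well.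
    refine tupleCone_mem_tupleSpan (P := {w | (∀ j, w j ∈ C ∩
      Metric.closedBall (tupleBarycenter k v) ((N / (N + 1) : ℝ) * D)) ∧
      ∀ i j, dist (w i) (w j) ≤ (N / (N + 1) : ℝ) * D}) ?_ (ih ?_ (by omega) ?_)
    · refine fun w hw => ⟨fun j => ?_, fun i j => ?_⟩
      · refine Fin.cases ?_ (fun j => ?_) j
        exacts [hC k v hv.1, (hw.1 j).1]
      · refine Fin.cases (Fin.cases ?_ (fun j => ?_) j) (fun i => Fin.cases ?_ (fun j => ?_) j) i
        · simpa using hq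
        · simpa [dist_comm] using (hw.1 j).2
        · simpa using (hw.1 i).2
        · simpa using hw.2 i j
    · intro l w hw
      exact ⟨hC l w fun j => (hw j).1, affineComb_mem_closedBall (fun j => (hw j).2) _⟩
    · exact tupleBoundary_of_mem_tupleSpan fun i => ⟨fun j => ⟨hv.1 _, hb _⟩, fun j l => hv.2 _ _⟩

/-- All new points lie in every closed `D`-ball that contains the vertices of `v`. Such points are
within `D` of each vertex, so the `D`-ball about any one of them contains the vertices, and hence
all the others. -/
lemma tupleHomotopy_mem_mesh {D : ℝ} (k : ℕ) {c : TupleChain (stdSimplex ℝ ι) k}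
    (hc : c ∈ tupleSpan {v | ∀ i j, dist (v i) (v j) ≤ D}) :
    tupleHomotopy tupleBarycenter k c ∈ tupleSpan {v | ∀ i j, dist (v i) (v j) ≤ D} := by
  refine map_mem_of_mem_tupleSpan _ (fun v hv => ?_) hc
  have hC : ∀ l (w : Fin (l + 1) → stdSimplex ℝ ι),
      (∀ j, w j ∈ {p | ∀ q, (∀ i, v i ∈ Metric.closedBall q D) → p ∈ Metric.closedBall q D}) →
      tupleBarycenter l w ∈
        {p | ∀ q, (∀ i, v i ∈ Metric.closedBall q D) → p ∈ Metric.closedBall q D} :=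
    fun l w hw q hq => affineComb_mem_closedBall (fun j => hw j q hq) _
  have := tupleHomotopy_mem_of_range hC k (c := .of v)
    (of_mem_tupleSpan fun j q hq => hq j)
  refine map_mem_of_mem_tupleSpan (AddMonoidHom.id _) (fun w hw => ?_) this
  refine of_mem_tupleSpan fun i j => ?_
  refine hw i (w j) fun l => ?_
  rw [Metric.mem_closedBall, dist_comm]
  exact hw j (v l) fun m => hv m l

/-- The iterated barycentric subdivisions of a simplex have arbitrarily small mesh. -/
lemma exists_iterate_tupleSubdiv_mem_mesh {k : ℕ} (c : TupleChain (stdSimplex ℝ ι) k) {ε : ℝ}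
    (hε : 0 < ε) : ∃ M, ∀ m, M ≤ m → (tupleSubdiv tupleBarycenter k)^[m] c
      ∈ tupleSpan {v | ∀ i j, dist (v i) (v j) ≤ ε} := by
  obtain ⟨D, hD0, hD⟩ : ∃ D : ℝ, 0 ≤ D ∧ ∀ p q : stdSimplex ℝ ι, dist p q ≤ D := by
    refine ⟨Metric.diam (Set.univ : Set (stdSimplex ℝ ι)), Metric.diam_nonneg, fun p q => ?_⟩
    exact Metric.dist_le_diam_of_mem (isCompact_univ (X := stdSimplex ℝ ι)).isBounded trivial
      trivial
  have hq : (k / (k + 1) : ℝ) < 1 := (div_lt_one (by positivity)).2 (by simp)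
  have step : ∀ m, (tupleSubdiv tupleBarycenter k)^[m] c
      ∈ tupleSpan {v | (∀ j, v j ∈ (Set.univ : Set (stdSimplex ℝ ι))) ∧
        ∀ i j, dist (v i) (v j) ≤ (k / (k + 1) : ℝ) ^ m * D} := by
    intro m
    induction m with
    | zero =>
      induction c using FreeAbelianGroup.induction_on with
      | zero => exact zero_mem _
      | of v => exact of_mem_tupleSpan ⟨fun _ => trivial, fun i j => by simpa using hD _ _⟩
      | neg v h => exact neg_mem h
      | add x y hx hy => exact add_mem hx hy
    | succ m ih =>
      rw [Function.iterate_succ_apply', pow_succ', mul_assoc]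
      exact tupleSubdiv_mem_mesh (C := Set.univ) (fun _ _ _ => trivial) k (Nat.le_succ k) ih
  have hlim : Filter.Tendsto (fun m : ℕ => (k / (k + 1) : ℝ) ^ m * D) Filter.atTop (nhds 0) := by
    simpa using (tendsto_pow_atTop_nhds_zero_of_lt_one (by positivity) hq).mul_const D
  obtain ⟨M, hM⟩ := Filter.eventually_atTop.1 (hlim.eventually_lt_const hε)
  refine ⟨M, fun m hm => ?_⟩
  refine map_mem_of_mem_tupleSpan (AddMonoidHom.id _) (fun w hw => ?_) (step m)
  exact of_mem_tupleSpan fun i j => (hw.2 i j).trans (hM m hm).le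

end Affine

/-! ## Cochains that vanish on small singular simplices -/

section Small

variable {X : Type u} [TopologicalSpace X] {R : Type v} [Ring R]

/-- The singular simplicial set of `X`. -/
abbrev Sing (X : Type u) [TopologicalSpace X] : SSet.{u} := TopCat.toSSet.obj (TopCat.of X)

/-- Singular simplices are continuous maps from the standard simplex. -/
def simplexEquiv (X : Type u) [TopologicalSpace X] (k : ℕ) :
    Simplices (Sing X) k ≃ C(stdSimplex ℝ (Fin (k + 1)), X) :=
  TopCat.toSSetObjEquiv (TopCat.of X) (op (SimplexCategory.mk k))

/-- The continuous map induced by a map of the vertices. -/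
def simplexMap {k l : ℕ} (f : Fin k → Fin l) :
    C(stdSimplex ℝ (Fin k), stdSimplex ℝ (Fin l)) :=
  ⟨stdSimplex.map f, stdSimplex.continuous_map f⟩

lemma simplexEquiv_delta {k : ℕ} (σ : Simplices (Sing X) (k + 1)) (i : Fin (k + 2)) :
    simplexEquiv X k ((Sing X).δ i σ) = (simplexEquiv X (k + 1) σ).comp (simplexMap i.succAbove) :=
  rfl

lemma simplexEquiv_map {Y : Type u} [TopologicalSpace Y] (f : C(X, Y)) {k : ℕ}
    (σ : Simplices (Sing X) k) :
    simplexEquiv Y k ((TopCat.toSSet.map (TopCat.ofHom f)).app (op (SimplexCategory.mk k)) σ)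
      = f.comp (simplexEquiv X k σ) :=
  rfl

variable {ι : Type*} [Fintype ι]

/-- The value of a singular cochain on the affine chains in a standard simplex, mapped to `X` by a
continuous map. -/
def evalTuples {k : ℕ} (c : Cochain (Sing X) R k) (σ : C(stdSimplex ℝ ι, X)) :
    TupleChain (stdSimplex ℝ ι) (k + 1) →+ R :=
  FreeAbelianGroup.lift fun w =>
    c ((simplexEquiv X k).symm (σ.comp ⟨affineComb w, continuous_affineComb w⟩))

lemma evalTuples_of {k : ℕ} (c : Cochain (Sing X) R k) (σ : C(stdSimplex ℝ ι, X))
    (w : Fin (k + 1) → stdSimplex ℝ ι) :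
    evalTuples c σ (.of w)
      = c ((simplexEquiv X k).symm (σ.comp ⟨affineComb w, continuous_affineComb w⟩)) :=
  FreeAbelianGroup.lift_apply_of _ _

lemma exists_addMonoidHom_eq_iterate {A : Type*} [AddCommGroup A] (f : A →+ A) (m : ℕ) :
    ∃ g : A →+ A, ∀ x, f^[m] x = g x := by
  induction m with
  | zero => exact ⟨AddMonoidHom.id A, fun _ => rfl⟩
  | succ m ih =>
    obtain ⟨g, hg⟩ := ih
    exact ⟨f.comp g, fun x => by rw [Function.iterate_succ_apply', hg]; rfl⟩

lemma evalTuples_zero {k : ℕ} (σ : C(stdSimplex ℝ ι, X)) :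
    evalTuples (0 : Cochain (Sing X) R k) σ = 0 :=
  FreeAbelianGroup.lift_ext _ _ fun w => by rw [evalTuples_of]; rfl

lemma evalTuples_boundary {k : ℕ} (c : Cochain (Sing X) R k) (σ : C(stdSimplex ℝ ι, X))
    (x : TupleChain (stdSimplex ℝ ι) (k + 2)) :
    evalTuples c σ (tupleBoundary _ (k + 1) x) = evalTuples (coboundary _ R k c) σ x := by
  suffices h : (evalTuples c σ).comp (tupleBoundary _ (k + 1))
      = evalTuples (coboundary _ R k c) σ from DFunLike.congr_fun h x
  refine FreeAbelianGroup.lift_ext _ _ fun w => ?_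
  rw [AddMonoidHom.comp_apply, tupleBoundary_of, evalTuples_of, coboundary_apply, map_sum]
  refine Finset.sum_congr rfl fun i _ => ?_
  rw [map_zsmul, evalTuples_of]
  congr 2
  refine (simplexEquiv X k).injective ?_
  rw [simplexEquiv_delta, Equiv.apply_symm_apply, Equiv.apply_symm_apply]
  refine ContinuousMap.ext fun t => ?_
  exact congrArg σ (affineComb_map w i.succAbove t).symm

lemma evalTuples_comp_map {k m n : ℕ} (c : Cochain (Sing X) R k)
    (σ : C(stdSimplex ℝ (Fin n), X)) (f : Fin m → Fin n)
    (x : TupleChain (stdSimplex ℝ (Fin m)) (k + 1)) :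
    evalTuples c (σ.comp (simplexMap f)) x
      = evalTuples c σ (tupleMap (stdSimplex.map f) (k + 1) x) := by
  suffices h : evalTuples c (σ.comp (simplexMap f))
      = (evalTuples c σ).comp (tupleMap (stdSimplex.map f) (k + 1)) from DFunLike.congr_fun h x
  refine FreeAbelianGroup.lift_ext _ _ fun w => ?_
  rw [AddMonoidHom.comp_apply, tupleMap_of, evalTuples_of, evalTuples_of]
  congr 2
  refine ContinuousMap.ext fun t => ?_
  exact congrArg σ (map_affineComb w f t)

lemma evalTuples_vertex {k : ℕ} (c : Cochain (Sing X) R k) (σ : Simplices (Sing X) k) :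
    evalTuples c (simplexEquiv X k σ) (.of fun j => stdSimplex.vertex j) = c σ := by
  rw [evalTuples_of]
  congr 1
  refine (Equiv.symm_apply_eq _).2 (ContinuousMap.ext fun t => ?_)
  exact congrArg (simplexEquiv X k σ) (affineComb_vertex t)

lemma tupleBoundary_vertex (k : ℕ) :
    tupleBoundary (stdSimplex ℝ (Fin (k + 1))) k (.of fun j => stdSimplex.vertex j)
      = ∑ i : Fin (k + 1), (-1 : ℤ) ^ (i : ℕ) •
        tupleMap (stdSimplex.map i.succAbove) k (.of fun j => stdSimplex.vertex j) := by
  rw [tupleBoundary_of]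
  refine Finset.sum_congr rfl fun i _ => ?_
  rw [tupleMap_of]
  congr 2
  funext j
  exact (stdSimplex.map_vertex _ _).symm

/-- The cochain `c` vanishes on all singular simplices with image in `U`. -/
def VanishesOn {k : ℕ} (c : Cochain (Sing X) R k) (U : Set X) : Prop :=
  ∀ σ : Simplices (Sing X) k, (∀ t, simplexEquiv X k σ t ∈ U) → c σ = 0

/-- Take half a Lebesgue number of the pulled-back cover: an affine simplex whose vertices are that
close to its first vertex lies in one ball, hence is mapped into one `U j`. -/
lemma exists_evalTuples_eq_zero {J : Type*} {U : J → Set X} (hU : ∀ j, IsOpen (U j))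
    (hcov : ∀ x, ∃ j, x ∈ U j) {k : ℕ} {c : Cochain (Sing X) R k}
    (hc : ∀ j, VanishesOn c (U j)) (σ : C(stdSimplex ℝ ι, X)) :
    ∃ ε > 0, ∀ x ∈ tupleSpan {v | ∀ i j, dist (v i) (v j) ≤ ε}, evalTuples c σ x = 0 := by
  obtain ⟨δ, hδ, h⟩ := lebesgue_number_lemma_of_metric (isCompact_univ (X := stdSimplex ℝ ι))
    (c := fun j => σ ⁻¹' U j) (fun j => (hU j).preimage σ.continuous)
    (fun t _ => Set.mem_iUnion.2 (hcov (σ t)))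
  refine ⟨δ / 2, by positivity, fun x hx => ?_⟩
  refine (AddSubgroup.mem_bot).1 (map_mem_of_mem_tupleSpan (G := ⊥) _ (fun v hv => ?_) hx)
  rw [AddSubgroup.mem_bot, evalTuples_of]
  obtain ⟨j, hj⟩ := h (v 0) trivial
  refine hc j _ fun t => ?_
  rw [Equiv.apply_symm_apply]
  refine hj (Metric.closedBall_subset_ball (half_lt_self hδ) ?_)
  exact affineComb_mem_closedBall (fun i => hv i 0) t

/-- A cocycle of positive degree which vanishes on all singular simplices lying in one of the sets
of an open cover is a coboundary. -/
theorem mem_coboundaries_of_vanishesOn {J : Type*} {U : J → Set X} (hU : ∀ j, IsOpen (U j))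
    (hcov : ∀ x, ∃ j, x ∈ U j) {k : ℕ} {c : Cochain (Sing X) R (k + 1)}
    (hcoc : c ∈ cocycles (Sing X) R (k + 1)) (hc : ∀ j, VanishesOn c (U j)) :
    c ∈ coboundaries (Sing X) R (k + 1) := by
  have hc0 : coboundary _ R _ c = 0 := hcoc
  let e : ∀ l : ℕ, TupleChain (stdSimplex ℝ (Fin (l + 1))) (l + 1) :=
    fun l => .of fun j => stdSimplex.vertex j
  let S := fun l : ℕ => tupleSubdiv (K := stdSimplex ℝ (Fin (l + 1))) tupleBarycenter
  let T := fun l : ℕ => tupleHomotopy (K := stdSimplex ℝ (Fin (l + 1))) tupleBarycenter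
  -- The primitive is the evaluation of `c` on the formal series `∑ₘ T Sᵐ`. Only finitely many terms
  -- contribute for each simplex, since `T` does not increase the mesh and `Sᵐ` makes it small.
  have hfin : ∀ τ : Simplices (Sing X) k, ∃ M, ∀ m, M ≤ m →
      evalTuples c (simplexEquiv X k τ) (T k (k + 1) ((S k (k + 1))^[m] (e k))) = 0 := by
    intro τ
    obtain ⟨ε, hε, h⟩ := exists_evalTuples_eq_zero hU hcov hc (simplexEquiv X k τ)
    obtain ⟨M, hM⟩ := exists_iterate_tupleSubdiv_mem_mesh (e k) hε
    exact ⟨M, fun m hm => h _ (tupleHomotopy_mem_mesh _ (hM m hm))⟩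
  choose M hM using hfin
  have hM' : ∀ τ M', M τ ≤ M' → ∑ m ∈ Finset.range (M τ),
      evalTuples c (simplexEquiv X k τ) (T k (k + 1) ((S k (k + 1))^[m] (e k)))
      = ∑ m ∈ Finset.range M',
      evalTuples c (simplexEquiv X k τ) (T k (k + 1) ((S k (k + 1))^[m] (e k))) := by
    intro τ M' h
    refine Finset.sum_subset (Finset.range_mono h) fun m _ hm => hM τ m ?_
    simpa using hm
  refine ⟨fun τ => ∑ m ∈ Finset.range (M τ),
    evalTuples c (simplexEquiv X k τ) (T k (k + 1) ((S k (k + 1))^[m] (e k))), ?_⟩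
  funext σ
  obtain ⟨ε, hε, h⟩ := exists_evalTuples_eq_zero hU hcov hc (simplexEquiv X (k + 1) σ)
  obtain ⟨M₀, hM₀⟩ := exists_iterate_tupleSubdiv_mem_mesh (e (k + 1)) hε
  -- A common truncation for all faces of `σ`, large enough that `c` also vanishes on the `N`-fold
  -- subdivision of `σ` itself.
  set N := max M₀ (Finset.univ.sup fun i : Fin (k + 2) => M ((Sing X).δ i σ)) with hN
  have hNi : ∀ i, M ((Sing X).δ i σ) ≤ N := fun i =>
    (Finset.le_sup (f := fun i : Fin (k + 2) => M ((Sing X).δ i σ)) (Finset.mem_univ i)).trans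
      (le_max_right _ _)
  have hnat : ∀ (i : Fin (k + 2)) (m : ℕ),
      evalTuples c (simplexEquiv X k ((Sing X).δ i σ)) (T k (k + 1) ((S k (k + 1))^[m] (e k)))
      = evalTuples c (simplexEquiv X (k + 1) σ) (T (k + 1) (k + 1) ((S (k + 1) (k + 1))^[m]
        (tupleMap (stdSimplex.map i.succAbove) (k + 1) (e k)))) := by
    intro i m
    have hb : ∀ (l : ℕ) (v : Fin (l + 1) → stdSimplex ℝ (Fin (k + 1))),
        stdSimplex.map i.succAbove (tupleBarycenter l v)
          = tupleBarycenter l (stdSimplex.map i.succAbove ∘ v) := fun l v => map_affineComb _ _ _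
    have hS : Function.Semiconj (tupleMap (stdSimplex.map i.succAbove) (k + 1))
        (S k (k + 1)) (S (k + 1) (k + 1)) := fun x => tupleMap_subdiv hb _ x
    rw [simplexEquiv_delta, evalTuples_comp_map]
    change evalTuples c _ (tupleMap _ (k + 1 + 1) (T k (k + 1) _)) = _
    rw [tupleMap_homotopy hb, (hS.iterate_right m).eq]
  have hcomm : ∀ m x, tupleBoundary _ (k + 1) ((S (k + 1) (k + 2))^[m] x)
      = (S (k + 1) (k + 1))^[m] (tupleBoundary _ (k + 1) x) := fun m x =>
    (Function.Semiconj.iterate_right (f := tupleBoundary _ (k + 1))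
      (fun y => tupleBoundary_subdiv tupleBarycenter (k + 1) y) m).eq x
  -- The homotopy formula gives `T ∂ Sᵐ = Sᵐ - Sᵐ⁺¹ - ∂ T Sᵐ`, and `c` kills boundaries because it
  -- is a cocycle. The sum over `m` therefore telescopes.
  have hterm : ∀ m, ∑ i : Fin (k + 2), (-1 : ℤ) ^ (i : ℕ) •
      evalTuples c (simplexEquiv X k ((Sing X).δ i σ)) (T k (k + 1) ((S k (k + 1))^[m] (e k)))
      = evalTuples c (simplexEquiv X (k + 1) σ) ((S (k + 1) (k + 2))^[m] (e (k + 1)))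
        - evalTuples c (simplexEquiv X (k + 1) σ) ((S (k + 1) (k + 2))^[m + 1] (e (k + 1))) := by
    intro m
    have hlin : ∑ i : Fin (k + 2), (-1 : ℤ) ^ (i : ℕ) • (T (k + 1) (k + 1)
        ((S (k + 1) (k + 1))^[m] (tupleMap (stdSimplex.map i.succAbove) (k + 1) (e k))))
        = T (k + 1) (k + 1) (tupleBoundary _ (k + 1) ((S (k + 1) (k + 2))^[m] (e (k + 1)))) := by
      obtain ⟨P, hP⟩ := exists_addMonoidHom_eq_iterate (S (k + 1) (k + 1)) m
      rw [hcomm, tupleBoundary_vertex, hP, map_sum, map_sum]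
      simp only [map_zsmul, hP]
      rfl
    simp only [hnat]
    rw [Function.iterate_succ_apply', ← map_sub]
    have := tupleBoundary_homotopy tupleBarycenter (k + 1) ((S (k + 1) (k + 2))^[m] (e (k + 1)))
    rw [eq_sub_iff_add_eq] at this
    change _ = evalTuples c _ (_ - tupleSubdiv _ _ _)
    rw [← this, map_add, evalTuples_boundary, hc0, ← hlin, map_sum]
    simp only [map_zsmul]
    rw [evalTuples_zero, AddMonoidHom.zero_apply, zero_add]
  rw [coboundary_apply]
  simp only [hM' _ N (hNi _), Finset.smul_sum]
  rw [Finset.sum_comm]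
  simp only [hterm]
  rw [Finset.sum_range_sub', h _ (hM₀ N (le_max_left _ _)), sub_zero]
  exact evalTuples_vertex c σ

end Small

/-! ## Null-homotopies and cohomology -/

section Cone

/-- The map `(x, s) ↦ (s, (1 - s) x)` from the cylinder over a simplex onto the simplex of the next
dimension. -/
def coneCoord (k : ℕ) (q : stdSimplex ℝ (Fin k) × unitInterval) : stdSimplex ℝ (Fin (k + 1)) :=
  ⟨Fin.cons (q.2 : ℝ) fun j => (1 - q.2 : ℝ) * q.1 j, by
    constructor
    · refine Fin.cases q.2.2.1 fun j => ?_
      exact mul_nonneg (sub_nonneg.2 q.2.2.2) (q.1.2.1 j)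
    · rw [Fin.sum_cons, ← Finset.mul_sum, stdSimplex.sum_eq_one]
      ring⟩

lemma coneCoord_zero {k : ℕ} (q : stdSimplex ℝ (Fin k) × unitInterval) :
    coneCoord k q 0 = q.2 := rfl

lemma coneCoord_succ {k : ℕ} (q : stdSimplex ℝ (Fin k) × unitInterval) (j : Fin k) :
    coneCoord k q j.succ = (1 - q.2 : ℝ) * q.1 j := rfl

lemma continuous_coneCoord (k : ℕ) : Continuous (coneCoord k) := by
  refine Continuous.subtype_mk (continuous_pi (Fin.cases ?_ fun j => ?_)) _
  · exact continuous_subtype_val.comp continuous_snd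
  · exact (continuous_const.sub (continuous_subtype_val.comp continuous_snd)).mul
      ((continuous_apply j).comp (continuous_subtype_val.comp continuous_fst))

lemma surjective_coneCoord (k : ℕ) : Function.Surjective (coneCoord (k + 1)) := by
  intro t
  have hsum : t 0 + ∑ j : Fin (k + 1), t j.succ = 1 := by
    rw [← Fin.sum_univ_succ, stdSimplex.sum_eq_one]
  have hI : t 0 ∈ unitInterval := ⟨t.2.1 0, stdSimplex.le_one t 0⟩
  by_cases h : t 0 = 1
  · refine ⟨(stdSimplex.vertex 0, ⟨t 0, hI⟩), stdSimplex.ext (funext (Fin.cases rfl fun j => ?_))⟩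
    rw [coneCoord_succ, show (1 - ((⟨t 0, hI⟩ : unitInterval) : ℝ)) = 0 from sub_eq_zero.2 h.symm,
      zero_mul]
    rw [h, add_eq_left, Finset.sum_eq_zero_iff_of_nonneg fun j _ => stdSimplex.zero_le t _] at hsum
    exact (hsum j (Finset.mem_univ j)).symm
  · have h' : 0 < 1 - t 0 := sub_pos.2 (lt_of_le_of_ne hI.2 h)
    refine ⟨(⟨fun j => t j.succ / (1 - t 0), fun j => div_nonneg (t.2.1 _) h'.le, ?_⟩,
      ⟨t 0, hI⟩), stdSimplex.ext (funext (Fin.cases rfl fun j => ?_))⟩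
    · rw [← Finset.sum_div, div_eq_one_iff_eq h'.ne']
      linarith
    · rw [coneCoord_succ]
      exact mul_div_cancel₀ _ h'.ne'

/-- A continuous surjection from a compact space to a Hausdorff space. Maps on the cone can
therefore be defined on the cylinder, where only the end `s = 1` is collapsed. -/
lemma isQuotientMap_coneCoord (k : ℕ) : Topology.IsQuotientMap (coneCoord (k + 1)) :=
  (continuous_coneCoord _).isClosedMap.isQuotientMap (continuous_coneCoord _)
    (surjective_coneCoord k)

lemma coneCoord_eq {k : ℕ} {q q' : stdSimplex ℝ (Fin k) × unitInterval}
    (h : coneCoord k q = coneCoord k q') : q.2 = q'.2 ∧ (q.1 = q'.1 ∨ q.2 = 1) := by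
  have h0 : q.2 = q'.2 := Subtype.ext (DFunLike.congr_fun h 0)
  refine ⟨h0, or_iff_not_imp_right.2 fun h1 => stdSimplex.ext (funext fun j => ?_)⟩
  have h2 : (1 - q.2 : ℝ) ≠ 0 := fun e => h1 (Subtype.ext (sub_eq_zero.1 e).symm)
  have := DFunLike.congr_fun h j.succ
  rw [coneCoord_succ, coneCoord_succ, ← h0] at this
  exact mul_left_cancel₀ h2 this

lemma map_succAbove_zero {k : ℕ} (x : stdSimplex ℝ (Fin k)) :
    stdSimplex.map (0 : Fin (k + 1)).succAbove x = coneCoord k (x, 0) := by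
  refine stdSimplex.ext (funext (Fin.cases ?_ fun j => ?_))
  · rw [coneCoord_zero, stdSimplex.map_coe, FunOnFinite.linearMap_apply_apply]
    refine Finset.sum_eq_zero fun i hi => ?_
    simp at hi
  · rw [coneCoord_succ, stdSimplex.map_coe, FunOnFinite.linearMap_apply_apply]
    have : ({x | (0 : Fin (k + 1)).succAbove x = j.succ} : Finset (Fin k)) = {j} := by
      ext i; simp
    rw [this, Finset.sum_singleton]
    simp

lemma map_succAbove_succ {k : ℕ} (i : Fin (k + 1)) (q : stdSimplex ℝ (Fin k) × unitInterval) :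
    stdSimplex.map i.succ.succAbove (coneCoord k q)
      = coneCoord (k + 1) (stdSimplex.map i.succAbove q.1, q.2) := by
  refine stdSimplex.ext (funext (Fin.cases ?_ fun j => ?_))
  · rw [coneCoord_zero, stdSimplex.map_coe, FunOnFinite.linearMap_apply_apply]
    have : ({x | i.succ.succAbove x = 0} : Finset (Fin (k + 1))) = {0} := by
      ext l
      refine Fin.cases ?_ (fun l => ?_) l <;> simp [Fin.succ_ne_zero]
    rw [this, Finset.sum_singleton, coneCoord_zero]
  · rw [coneCoord_succ, stdSimplex.map_coe, stdSimplex.map_coe, FunOnFinite.linearMap_apply_apply,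
      FunOnFinite.linearMap_apply_apply, Finset.mul_sum, Finset.sum_filter, Fin.sum_univ_succ,
      Finset.sum_filter]
    simp only [Fin.succ_succAbove_zero, Fin.succ_succAbove_succ, Fin.succ_inj,
      coneCoord_succ, (Fin.succ_ne_zero j).symm, if_false, zero_add]

variable {X Y : Type u} [TopologicalSpace X] [TopologicalSpace Y] {R : Type v} [Ring R]
  {Z : Type u} [TopologicalSpace Z]

lemma factorsThrough_coneCoord (G : C(Z × unitInterval, Y)) {p : Y} (hG : ∀ z, G (z, 1) = p)
    {k : ℕ} (τ : C(stdSimplex ℝ (Fin (k + 1)), Z)) :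
    Function.FactorsThrough (G.comp (τ.prodMap (ContinuousMap.id unitInterval)))
      (⟨coneCoord (k + 1), continuous_coneCoord _⟩ : C(_, _)) := by
  intro q q' h
  obtain ⟨h1, h2 | h2⟩ := coneCoord_eq h
  · rw [Prod.ext h2 h1]
  · have e : ∀ r : stdSimplex ℝ (Fin (k + 1)) × unitInterval, r.2 = 1 →
        (G.comp (τ.prodMap (ContinuousMap.id _))) r = p := by
      rintro ⟨x, s⟩ rfl
      exact hG _
    rw [e q h2, e q' (h1 ▸ h2)]

/-- The cone over a map `τ` of a simplex along a homotopy that ends at a constant map. -/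
def coneSimplex (G : C(Z × unitInterval, Y)) {p : Y} (hG : ∀ z, G (z, 1) = p) {k : ℕ}
    (τ : C(stdSimplex ℝ (Fin (k + 1)), Z)) : C(stdSimplex ℝ (Fin (k + 2)), Y) :=
  (isQuotientMap_coneCoord k).lift (f := ⟨coneCoord (k + 1), continuous_coneCoord _⟩)
    (G.comp (τ.prodMap (ContinuousMap.id _))) (factorsThrough_coneCoord G hG τ)

lemma coneSimplex_coneCoord (G : C(Z × unitInterval, Y)) {p : Y} (hG : ∀ z, G (z, 1) = p) {k : ℕ}
    (τ : C(stdSimplex ℝ (Fin (k + 1)), Z)) (q : stdSimplex ℝ (Fin (k + 1)) × unitInterval) :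
    coneSimplex G hG τ (coneCoord (k + 1) q) = G (τ q.1, q.2) :=
  DFunLike.congr_fun ((isQuotientMap_coneCoord k).lift_comp
    (f := ⟨coneCoord (k + 1), continuous_coneCoord _⟩) (G.comp (τ.prodMap (ContinuousMap.id _)))
    (factorsThrough_coneCoord G hG τ)) q

lemma coneSimplex_comp_zero (G : C(Z × unitInterval, Y)) {p : Y} (hG : ∀ z, G (z, 1) = p) {k : ℕ}
    (τ : C(stdSimplex ℝ (Fin (k + 1)), Z)) (x : stdSimplex ℝ (Fin (k + 1))) :
    (coneSimplex G hG τ).comp (simplexMap (0 : Fin (k + 2)).succAbove) x = G (τ x, 0) := by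
  change coneSimplex G hG τ (stdSimplex.map _ x) = _
  rw [map_succAbove_zero, coneSimplex_coneCoord]

lemma coneSimplex_comp_succ (G : C(Z × unitInterval, Y)) {p : Y} (hG : ∀ z, G (z, 1) = p) {k : ℕ}
    (τ : C(stdSimplex ℝ (Fin (k + 2)), Z)) (i : Fin (k + 2)) :
    (coneSimplex G hG τ).comp (simplexMap i.succ.succAbove)
      = coneSimplex G hG (τ.comp (simplexMap i.succAbove)) := by
  refine ContinuousMap.ext fun t => ?_
  obtain ⟨q, rfl⟩ := surjective_coneCoord k t
  change coneSimplex G hG τ (stdSimplex.map _ _) = _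
  rw [map_succAbove_succ, coneSimplex_coneCoord, coneSimplex_coneCoord]
  rfl

/-- If `f` is null-homotopic on `U`, then the pull-back of a cocycle of positive degree along `f`
is a coboundary on `U`. -/
theorem exists_vanishesOn_pullback_sub_coboundary {U : Set X} (f : C(X, Y))
    (G : C(U × unitInterval, Y)) {p : Y} (h0 : ∀ y : U, G (y, 0) = f y) (h1 : ∀ y, G (y, 1) = p)
    {k : ℕ} {c : Cochain (Sing Y) R (k + 1)} (hc : c ∈ cocycles (Sing Y) R (k + 1)) :
    ∃ η : Cochain (Sing X) R k,
      VanishesOn (cochainPullback R (TopCat.toSSet.map (TopCat.ofHom f)) (k + 1) c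
        - coboundary (Sing X) R k η) U := by
  classical
  let lift : ∀ {l : ℕ} (σ : C(stdSimplex ℝ (Fin (l + 1)), X)), (∀ t, σ t ∈ U) →
      C(stdSimplex ℝ (Fin (l + 1)), U) := fun σ h => ⟨fun t => ⟨σ t, h t⟩, by fun_prop⟩
  -- The cochain evaluates `c` on the cone over a simplex; its value on simplices not in `U` is
  -- irrelevant.
  refine ⟨fun τ => if h : ∀ t, simplexEquiv X k τ t ∈ U then
    c ((simplexEquiv Y (k + 1)).symm (coneSimplex G h1 (lift _ h))) else 0, fun σ hσ => ?_⟩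
  -- The cocycle condition on the cone over `σ`: the face opposite the apex is `f ∘ σ`, and the
  -- others are the cones over the faces of `σ`.
  have hd := congrFun (show coboundary _ R _ c = 0 from hc)
    ((simplexEquiv Y (k + 2)).symm (coneSimplex G h1 (lift _ hσ)))
  rw [coboundary_apply, Fin.sum_univ_succ, Pi.zero_apply, Fin.val_zero, pow_zero, one_smul] at hd
  rw [Pi.sub_apply, sub_eq_zero, coboundary_apply, ← sub_eq_zero, ← hd, sub_eq_add_neg,
    ← Finset.sum_neg_distrib]
  congr 1
  · refine congrArg c ((simplexEquiv Y (k + 1)).injective ?_)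
    rw [simplexEquiv_map, simplexEquiv_delta, Equiv.apply_symm_apply]
    refine ContinuousMap.ext fun t => ?_
    rw [coneSimplex_comp_zero, h0]
    rfl
  · refine Finset.sum_congr rfl fun i _ => ?_
    rw [Fin.val_succ, pow_succ, mul_neg_one, neg_smul,
      dif_pos (show ∀ t, simplexEquiv X k ((Sing X).δ i σ) t ∈ U from fun t => hσ _)]
    refine congrArg (fun z => -((-1 : ℤ) ^ (i : ℕ) • c z)) ?_
    refine (Equiv.symm_apply_eq _).2 ?_
    exact (coneSimplex_comp_succ G h1 (lift _ hσ) i).symm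

end Cone

/-! ## Cup products of classes that vanish on the sets of an open cover -/

section CupLength

variable {X : Type u} [TopologicalSpace X] {R : Type v} [Ring R]

/-- The class `a` has a representing cocycle that vanishes on the singular simplices in `U`. -/
def HasRepVanishingOn {k : ℕ} (a : SCohomology (Sing X) R k) (U : Set X) : Prop :=
  ∃ φ : cocycles (Sing X) R k, QuotientAddGroup.mk φ = a ∧ VanishesOn φ.1 U

lemma VanishesOn.cup_left {p q n : ℕ} (h : p + q = n) {φ : Cochain (Sing X) R p} {U : Set X}
    (hφ : VanishesOn φ U) (ψ : Cochain (Sing X) R q) : VanishesOn (cochainCup h φ ψ) U := by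
  intro σ hσ
  rw [cochainCup, hφ _ fun t => hσ _, zero_mul]

lemma VanishesOn.cup_right {p q n : ℕ} (h : p + q = n) (φ : Cochain (Sing X) R p)
    {ψ : Cochain (Sing X) R q} {U : Set X} (hψ : VanishesOn ψ U) :
    VanishesOn (cochainCup h φ ψ) U := by
  intro σ hσ
  rw [cochainCup, hψ _ fun t => hσ _, mul_zero]

/-- A cup product has a representing cocycle that vanishes on the singular simplices lying in one of
the sets on which the factors are represented by vanishing cocycles. -/
lemma exists_rep_cupProd_vanishesOn (n : ℕ) (k : Fin n → ℕ)
    (α : ∀ i, SCohomology (Sing X) R (k i)) (U : Fin n → Set X)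
    (h : ∀ i, HasRepVanishingOn (α i) (U i)) :
    ∃ φ : cocycles (Sing X) R
        (cupProd (List.ofFn fun i => (⟨k i, α i⟩ : Σ l, SCohomology (Sing X) R l))).1,
      QuotientAddGroup.mk φ
        = (cupProd (List.ofFn fun i => (⟨k i, α i⟩ : Σ l, SCohomology (Sing X) R l))).2 ∧
      ∀ i, VanishesOn φ.1 (U i) := by
  induction n with
  | zero =>
    obtain ⟨φ, hφ⟩ := QuotientAddGroup.mk_surjective
      (cupProd (List.ofFn fun i => (⟨k i, α i⟩ : Σ k, SCohomology (Sing X) R k))).2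
    exact ⟨φ, hφ, fun i => i.elim0⟩
  | succ n ih =>
    obtain ⟨ψ, hψ, hψU⟩ := ih (fun i => k i.succ) (fun i => α i.succ) (fun i => U i.succ)
      fun i => h i.succ
    obtain ⟨φ, hφ, hφU⟩ := h 0
    rw [List.ofFn_succ]
    refine ⟨⟨cochainCup rfl φ.1 ψ.1, cup_mem_cocycles rfl φ.2 ψ.2⟩, ?_, Fin.cases ?_ fun i => ?_⟩
    · change _ = cup (α 0) (cupProd (List.ofFn fun i : Fin n => ⟨k i.succ, α i.succ⟩)).2
      rw [← hφ, ← hψ]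
      rfl
    · exact hφU.cup_left rfl _
    · exact (hψU i).cup_right rfl _

lemma le_degree_cupProd {S : SSet.{u}} (n : ℕ) (k : Fin (n + 1) → ℕ)
    (α : ∀ i, SCohomology S R (k i)) :
    k 0 ≤ (cupProd (List.ofFn fun i => (⟨k i, α i⟩ : Σ k, SCohomology S R k))).1 := by
  rw [List.ofFn_succ, cupProd]
  exact Nat.le_add_right _ _

/-- The cup product of `n ≥ 1` classes of positive degree vanishes if the space is covered by
open sets such that the `i`-th class has a representative that vanishes on the `i`-th set. -/
theorem cupProd_eq_zero (n : ℕ) (k : Fin (n + 1) → ℕ) (hk : 1 ≤ k 0)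
    (α : ∀ i, SCohomology (Sing X) R (k i)) (U : Fin (n + 1) → Set X) (hU : ∀ i, IsOpen (U i))
    (hcov : ∀ x, ∃ i, x ∈ U i) (h : ∀ i, HasRepVanishingOn (α i) (U i)) :
    (cupProd (List.ofFn fun i => (⟨k i, α i⟩ : Σ k, SCohomology (Sing X) R k))).2 = 0 := by
  obtain ⟨φ, hφ, hφU⟩ := exists_rep_cupProd_vanishesOn _ k α U h
  have hpos := hk.trans (le_degree_cupProd n k α)
  -- The degree must become a variable before it can be replaced by a successor.
  generalize cupProd (List.ofFn fun i => (⟨k i, α i⟩ : Σ k, SCohomology (Sing X) R k)) = P at *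
  obtain ⟨N, β⟩ := P
  obtain ⟨N, rfl⟩ : ∃ M, N = M + 1 := ⟨N - 1, by dsimp only at hpos; omega⟩
  refine hφ.symm.trans ((QuotientAddGroup.eq_zero_iff _).2 ?_)
  exact mem_coboundaries_of_vanishesOn hU hcov φ.2 hφU

/-- Pull-backs of classes of positive degree along a map that is null-homotopic on `U` are
represented by cocycles that vanish on `U`. -/
theorem hasRepVanishingOn_singularPullback {Y : Type u} [TopologicalSpace Y] {U : Set X}
    (f : C(X, Y)) (G : C(U × unitInterval, Y)) {p : Y} (h0 : ∀ y : U, G (y, 0) = f y)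
    (h1 : ∀ y, G (y, 1) = p) {k : ℕ} (hk : 1 ≤ k) (a : SingularCohomology k Y R) :
    HasRepVanishingOn (singularPullback R f k a) U := by
  obtain ⟨k, rfl⟩ : ∃ l, k = l + 1 := ⟨k - 1, by omega⟩
  obtain ⟨⟨c, hc⟩, rfl⟩ := QuotientAddGroup.mk_surjective a
  obtain ⟨η, hη⟩ := exists_vanishesOn_pullback_sub_coboundary f G h0 h1 hc
  have hp : cochainPullback R (TopCat.toSSet.map (TopCat.ofHom f)) (k + 1) c
      ∈ cocycles (Sing X) R (k + 1) := by
    change coboundary _ R _ _ = 0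
    rw [coboundary_pullback, show coboundary _ R _ c = 0 from hc, map_zero]
  refine ⟨⟨_, sub_mem hp (coboundary_coboundary k η)⟩, ?_, hη⟩
  refine QuotientAddGroup.eq.2 ?_
  rw [AddSubgroup.mem_addSubgroupOf]
  refine ⟨η, ?_⟩
  change _ = -(_ - _) + cochainPullback R (TopCat.toSSet.map (TopCat.ofHom f)) (k + 1) c
  abel

end CupLength

/-! ## Closed embeddings into normed spaces -/

section Embedding

variable (X : Type u) [MetricSpace X]

/-- The `1`-Lipschitz functions on `X` with values in `[0, 1]`. -/
def LipFun : Type u := {f : X → ℝ // LipschitzWith 1 f ∧ ∀ x, f x ∈ Set.Icc (0 : ℝ) 1}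

instance : TopologicalSpace (LipFun X) := ⊥

instance : DiscreteTopology (LipFun X) := ⟨rfl⟩

variable {X}

/-- The evaluation at a point, as a bounded function on the set of `1`-Lipschitz functions. -/
def lipEval (x : X) : BoundedContinuousFunction (LipFun X) ℝ :=
  BoundedContinuousFunction.ofNormedAddCommGroupDiscrete (fun f => f.1 x) 1 fun f => by
    rw [Real.norm_of_nonneg (f.2.2 x).1]
    exact (f.2.2 x).2

lemma lipEval_apply (x : X) (f : LipFun X) : lipEval x f = f.1 x := rfl

lemma dist_lipEval_le (x y : X) : dist (lipEval x) (lipEval y) ≤ dist x y := by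
  rw [BoundedContinuousFunction.dist_le dist_nonneg]
  intro f
  rw [lipEval_apply, lipEval_apply]
  simpa using f.2.1.dist_le_mul x y

/-- The truncated distance to a set. -/
def truncInfDist (S : Set X) : LipFun X :=
  ⟨fun x => min (Metric.infDist x S) 1, (Metric.lipschitz_infDist_pt S).min_const 1,
    fun _ => ⟨le_min Metric.infDist_nonneg zero_le_one, min_le_right _ _⟩⟩

variable (X) in
/-- The linear span of the evaluations. -/
abbrev LipSpan : Type u := Submodule.span ℝ (Set.range (lipEval (X := X)))

/-- The embedding of `X` into the span of the evaluations. -/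
def lipEmbed (x : X) : LipSpan X := ⟨lipEval x, Submodule.subset_span ⟨x, rfl⟩⟩

lemma dist_lipEmbed_le (x y : X) : dist (lipEmbed x) (lipEmbed y) ≤ dist x y :=
  dist_lipEval_le x y

lemma lipEmbed_injective : Function.Injective (lipEmbed (X := X)) := by
  intro x y h
  have h1 : lipEval x = lipEval y := congrArg Subtype.val h
  have h2 : min (Metric.infDist x {y}) 1 = min (Metric.infDist y {y}) 1 :=
    DFunLike.congr_fun h1 (truncInfDist {y})
  rw [Metric.infDist_singleton, Metric.infDist_singleton, dist_self, min_eq_left zero_le_one] at h2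
  rcases min_eq_iff.1 h2 with h3 | h3
  · exact dist_eq_zero.1 h3.1
  · exact absurd h3.1 one_ne_zero

/-- A finite combination of evaluations sees a function only at finitely many points. This is why
the span is used as the ambient space: the image of `X` is closed in it. -/
lemma exists_finite_forall_eq_zero (z : LipSpan X) :
    ∃ S : Set X, S.Finite ∧ ∀ f : LipFun X, (∀ x ∈ S, f.1 x = 0) → z.1 f = 0 := by
  obtain ⟨z, hz⟩ := z
  induction hz using Submodule.span_induction with
  | mem z hz =>
    obtain ⟨x, rfl⟩ := hz
    exact ⟨{x}, Set.finite_singleton x, fun f hf => hf x rfl⟩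
  | zero => exact ⟨∅, Set.finite_empty, fun _ _ => rfl⟩
  | add y z _ _ hy hz =>
    obtain ⟨S, hS, h⟩ := hy
    obtain ⟨T, hT, h'⟩ := hz
    refine ⟨S ∪ T, hS.union hT, fun f hf => ?_⟩
    change y f + z f = 0
    rw [h f fun x hx => hf x (.inl hx), h' f fun x hx => hf x (.inr hx), add_zero]
  | smul a z _ hz =>
    obtain ⟨S, hS, h⟩ := hz
    refine ⟨S, hS, fun f hf => ?_⟩
    change a * z f = 0
    rw [h f hf, mul_zero]

lemma continuous_lipEmbed : Continuous (lipEmbed (X := X)) :=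
  (LipschitzWith.of_dist_le_mul (K := 1) fun x y => by
    simpa using dist_lipEmbed_le x y).continuous

/-- Let `z` be a limit of image points outside the image of `C`. The truncated distance to the
finite set seen by `z` is killed by `z`, so points mapped close to `z` are close to that set. But
points of `C` near any fixed `s` have images bounded away from `z`. The extra point `c₀` only keeps
the finite set nonempty. -/
lemma isClosedMap_lipEmbed : IsClosedMap (lipEmbed (X := X)) := by
  intro C hC
  refine isClosed_of_closure_subset fun z hz => ?_
  by_contra hzC
  obtain ⟨S, hS, hzS⟩ := exists_finite_forall_eq_zero z
  obtain ⟨c₀, hc₀⟩ : C.Nonempty := by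
    have : (lipEmbed '' C).Nonempty := closure_nonempty_iff.1 ⟨z, hz⟩
    exact Set.image_nonempty.1 this
  have hloc : ∀ s : X, ∃ ε > 0, ∀ x ∈ C, dist x s < ε → ε ≤ dist (lipEmbed x) z := by
    intro s
    by_cases hs : s ∈ C
    · have hd : 0 < dist (lipEmbed s) z := dist_pos.2 fun h => hzC ⟨s, hs, h⟩
      refine ⟨dist (lipEmbed s) z / 2, by positivity, fun x _ hx => ?_⟩
      have h1 := dist_lipEmbed_le x s
      have h2 := dist_triangle_left (lipEmbed s) z (lipEmbed x)
      linarith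
    · obtain ⟨ε, hε, h⟩ := Metric.isOpen_iff.1 hC.isOpen_compl s hs
      exact ⟨ε, hε, fun x hx hxs => absurd hx (h hxs)⟩
  choose ε hε hεC using hloc
  obtain ⟨δ, hδ, hδS⟩ : ∃ δ > 0, ∀ s ∈ insert c₀ S, δ ≤ ε s := by
    obtain ⟨m, -, hm⟩ := Set.exists_min_image _ ε (hS.insert c₀) ⟨c₀, Set.mem_insert _ _⟩
    exact ⟨ε m, hε m, hm⟩
  obtain ⟨_, ⟨x, hx, rfl⟩, hxz⟩ := Metric.mem_closure_iff.1 hz (min δ 1) (by positivity)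
  have hf : min (Metric.infDist x (insert c₀ S)) 1 < min δ 1 := by
    have h1 : z.1 (truncInfDist (insert c₀ S)) = 0 := hzS _ fun y hy => by
      change min (Metric.infDist y (insert c₀ S)) 1 = 0
      rw [Metric.infDist_zero_of_mem (Set.mem_insert_of_mem _ hy), min_eq_left zero_le_one]
    have h2 := BoundedContinuousFunction.dist_coe_le_dist (f := z.1) (g := lipEval x)
      (truncInfDist (insert c₀ S))
    rw [h1, dist_zero_left] at h2
    exact (le_abs_self _).trans_lt (h2.trans_lt hxz)
  have hf' : Metric.infDist x (insert c₀ S) < δ := by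
    rcases min_lt_iff.1 hf with h | h
    · exact h.trans_le (min_le_left _ _)
    · exact absurd (h.trans_le (min_le_right _ _)) (lt_irrefl _)
  obtain ⟨s, hs, hxs⟩ := (Metric.infDist_lt_iff ⟨c₀, Set.mem_insert _ _⟩).1 hf'
  have h3 := hεC s x hx (hxs.trans_le (hδS s hs))
  rw [dist_comm] at h3
  exact absurd ((hδS s hs).trans h3) (not_le.2 (hxz.trans_le (min_le_left _ _)))

lemma isClosedEmbedding_lipEmbed : Topology.IsClosedEmbedding (lipEmbed (X := X)) :=
  .of_continuous_injective_isClosedMap continuous_lipEmbed lipEmbed_injective isClosedMap_lipEmbed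

end Embedding

/-! ## Averaging locally continuous configurations of paths -/

section Averaging

/-- Two matchings of a configuration with well separated configurations `p`, `p'` differ by a
matching of `p` and `p'`. -/
lemma matching_unique {P : Type*} [PseudoMetricSpace P] {i : ℕ} {p p' q : Fin i → P} {ε ε' : ℝ}
    (hp : ∀ j l, j ≠ l → 8 * ε ≤ dist (p j) (p l))
    (hp' : ∀ j l, j ≠ l → 8 * ε' ≤ dist (p' j) (p' l)) {m m' s : Equiv.Perm (Fin i)}
    (hm : ∀ j, dist (q (m j)) (p j) < ε) (hm' : ∀ j, dist (q (m' j)) (p' j) < ε')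
    (hs : ∀ j, dist (p' (s j)) (p j) < ε) (j : Fin i) : m j = m' (s j) := by
  by_contra hne
  obtain ⟨l, hl⟩ := m.surjective (m' (s j))
  have hjl : j ≠ l := fun h => hne (h ▸ hl)
  have h1 := hp j l hjl
  have h2 := hp' (s j) (s l) fun h => hjl (s.injective h)
  have h3 := hm l
  have h4 := hm' (s j)
  have h5 := hs j
  have h6 := hs l
  rw [hl] at h3
  -- If `q (m' (s j))` were matched to some `p l` with `l ≠ j`, then `8ε ≤ d(p j, p l) < 2ε + ε'`,
  -- while `8ε' < 2ε + d(p j, p l)`; these are incompatible.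
  have h7 := dist_triangle4 (p j) (p' (s j)) (q (m' (s j))) (p l)
  have h8 := dist_triangle4 (p' (s j)) (p j) (p l) (p' (s l))
  rw [dist_comm (p j) (p' (s j)), dist_comm (p' (s j)) (q _)] at h7
  rw [dist_comm (p l) (p' (s l))] at h8
  have h9 := dist_nonneg (x := p j) (y := p l)
  linarith

variable {X : Type u} [MetricSpace X] {E : Type*} [NormedAddCommGroup E]
  {e : X → E} {O : Set E} {A : Set X} {i : ℕ} {f : A → Fin i → C(unitInterval, X)}

/-- Finitely many conditions that hold for all small `ε > 0`, the second by compactness of the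
paths. The factor `8` makes matchings unique; the factor `3` absorbs the three errors in `path_mem`.
-/
lemma exists_pos_separated (he : Continuous e) (hO : IsOpen O) (heO : ∀ x, e x ∈ O)
    {p : Fin i → C(unitInterval, X)} (hp : Function.Injective p) :
    ∃ ε > 0, (∀ j l, j ≠ l → 8 * ε ≤ dist (p j) (p l)) ∧
      ∀ j t, Metric.ball (e (p j t)) (3 * ε) ⊆ O := by
  have h1 : ∀ j l, ∀ᶠ ε : ℝ in nhdsWithin 0 (Set.Ioi 0), j ≠ l → 8 * ε ≤ dist (p j) (p l) := by
    intro j l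
    by_cases h : j = l
    · exact Filter.Eventually.of_forall fun _ h' => absurd h h'
    · have h0 : 0 < dist (p j) (p l) := dist_pos.2 (hp.ne h)
      have hc : ContinuousAt (fun ε : ℝ => 8 * ε) 0 := by fun_prop
      filter_upwards [nhdsWithin_le_nhds (hc.eventually_lt_const
        (u := dist (p j) (p l)) (by simpa using hp.ne h))] with ε hε _
      exact hε.le
  have h2 : ∀ j, ∀ᶠ ε : ℝ in nhdsWithin 0 (Set.Ioi 0),
      ∀ t, Metric.ball (e (p j t)) (3 * ε) ⊆ O := by
    intro j
    have hK : IsCompact (Set.range fun t => e (p j t)) :=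
      isCompact_range (he.comp (p j).continuous)
    obtain ⟨δ, hδ, h⟩ := hK.exists_thickening_subset_open hO (by
      rintro _ ⟨t, rfl⟩
      exact heO _)
    have hc : ContinuousAt (fun ε : ℝ => 3 * ε) 0 := by fun_prop
    filter_upwards [nhdsWithin_le_nhds (hc.eventually_lt_const (by simpa using hδ))] with ε hε t
    exact (Metric.ball_subset_ball hε.le).trans
      ((Metric.ball_subset_thickening (Set.mem_range_self t) δ).trans h)
  obtain ⟨ε, ⟨hε1, hε2⟩, hε⟩ := ((Filter.eventually_all.2 fun j =>
    Filter.eventually_all.2 (h1 j)).and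
      (Filter.eventually_all.2 h2)).and self_mem_nhdsWithin |>.exists
  exact ⟨ε, hε, hε1, hε2⟩

/-- The data used to average configurations: a configuration of paths for each point of `A`, with
radii `ε a` and `ρ a` and a partition of unity subordinate to the balls of radius `ρ a`. -/
structure AveragingData (e : X → E) (O : Set E) (f : A → Fin i → C(unitInterval, X))
    (U : Set X) where
  /-- the scale on which the configuration is separated -/
  ε : A → ℝ
  /-- the radius on which the configuration varies little -/
  ρ : A → ℝ
  ρ_le : ∀ a, ρ a ≤ ε a
  separated : ∀ a j l, j ≠ l → 8 * ε a ≤ dist (f a j) (f a l)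
  ball_subset : ∀ a j t, Metric.ball (e (f a j t)) (3 * ε a) ⊆ O
  exists_perm : ∀ a b : A, dist (a : X) b < 2 * ρ a →
    ∃ s : Equiv.Perm (Fin i), ∀ j, dist (f b (s j)) (f a j) < ε a
  /-- the partition of unity -/
  w : PartitionOfUnity A U Set.univ
  subordinate : w.IsSubordinate fun a => {y | dist (y : X) a < ρ a}

namespace AveragingData

variable {U : Set X} (D : AveragingData e O f U)

/-- The matchings `m` are compatible with a reference point near `y`. -/
def Good (y : U) (m : A → Equiv.Perm (Fin i)) : Prop :=
  ∃ a : A, dist (y : X) a < D.ρ a ∧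
    ∀ b, D.w b y ≠ 0 → ∀ j, dist (f b (m b j)) (f a j) < D.ε a

lemma exists_good (y₀ : U) : ∃ m, ∀ᶠ y in nhds y₀, D.Good y m := by
  have hne : (D.w.fintsupport y₀).Nonempty := by
    obtain ⟨b, hb⟩ := D.w.exists_pos (Set.mem_univ y₀)
    exact ⟨b, D.w.finsupport_subset_fintsupport y₀ ((D.w.mem_finsupport y₀).2 hb.ne')⟩
  -- With the largest radius as reference, all other relevant indices lie within `2 * ρ a` of `a`,
  -- so their configurations can be matched to that of `a`.
  obtain ⟨a, ha, hmax⟩ := Finset.exists_max_image _ D.ρ hne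
  have hdist : ∀ b ∈ D.w.fintsupport y₀, dist (y₀ : X) b < D.ρ b := fun b hb =>
    D.subordinate b ((D.w.mem_fintsupport_iff y₀ b).1 hb)
  have hex : ∀ b : A, ∃ s : Equiv.Perm (Fin i), b ∈ D.w.fintsupport y₀ →
      ∀ j, dist (f b (s j)) (f a j) < D.ε a := by
    intro b
    by_cases hb : b ∈ D.w.fintsupport y₀
    · have h1 := dist_triangle_left (a : X) b y₀
      have h2 := hdist a ha
      have h3 := hdist b hb
      have h4 := hmax b hb
      obtain ⟨s, hs⟩ := D.exists_perm a b (by linarith)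
      exact ⟨s, fun _ => hs⟩
    · exact ⟨1, fun h => absurd h hb⟩
  choose m hm using hex
  refine ⟨m, ?_⟩
  have hopen : IsOpen {y : U | dist (y : X) a < D.ρ a} :=
    isOpen_lt (by fun_prop) continuous_const
  filter_upwards [D.w.eventually_finsupport_subset y₀, hopen.mem_nhds (hdist a ha)] with y hy hya
  exact ⟨a, hya, fun b hb => hm b (hy ((D.w.mem_finsupport y).2 hb))⟩

lemma Good.exists_perm {y : U} {m m' : A → Equiv.Perm (Fin i)} (h : D.Good y m)
    (h' : D.Good y m') :
    ∃ s : Equiv.Perm (Fin i), ∀ b, D.w b y ≠ 0 → ∀ j, m b j = m' b (s j) := by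
  obtain ⟨a, ha, hm⟩ := h
  obtain ⟨a', ha', hm'⟩ := h'
  have hd := dist_triangle_left (a : X) a' y
  rcases le_total (D.ρ a') (D.ρ a) with hle | hle
  · obtain ⟨s, hs⟩ := D.exists_perm a a' (by linarith)
    exact ⟨s, fun b hb => matching_unique (D.separated a) (D.separated a') (hm b hb) (hm' b hb) hs⟩
  · obtain ⟨s, hs⟩ := D.exists_perm a' a (by rw [dist_comm]; linarith)
    refine ⟨s⁻¹, fun b hb j => ?_⟩
    rw [matching_unique (D.separated a') (D.separated a) (hm' b hb) (hm b hb) hs (s⁻¹ j)]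
    simp

variable [NormedSpace ℝ E]

/-- The averages of matched paths. -/
def avg (m : A → Equiv.Perm (Fin i)) (j : Fin i) (q : U × unitInterval) : E :=
  ∑ᶠ b, D.w b q.1 • e (f b (m b j) q.2)

/-- The averages of matched paths, corrected such that they start at the given point. -/
def path (m : A → Equiv.Perm (Fin i)) (j : Fin i) (q : U × unitInterval) : E :=
  D.avg m j q + (1 - q.2 : ℝ) • (e q.1 - D.avg m j (q.1, 0))

lemma avg_eq_of_perm {y : U} {m m' : A → Equiv.Perm (Fin i)} {s : Equiv.Perm (Fin i)}
    (h : ∀ b, D.w b y ≠ 0 → ∀ j, m b j = m' b (s j)) (j : Fin i) (t : unitInterval) :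
    D.avg m j (y, t) = D.avg m' (s j) (y, t) := by
  refine finsum_congr fun b => ?_
  by_cases hb : D.w b y = 0
  · rw [hb, zero_smul, zero_smul]
  · rw [h b hb j]

lemma avg_mem_ball (he : ∀ x y, dist (e x) (e y) ≤ dist x y) {y : U}
    {m : A → Equiv.Perm (Fin i)} {a : A}
    (h : ∀ b, D.w b y ≠ 0 → ∀ j, dist (f b (m b j)) (f a j) < D.ε a) (j : Fin i)
    (t : unitInterval) : D.avg m j (y, t) ∈ Metric.ball (e (f a j t)) (D.ε a) :=
  D.w.finsum_smul_mem_convex (g := fun b _ => e (f b (m b j) t)) (Set.mem_univ y)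
    (fun b hb => Metric.mem_ball.2
      (((he _ _).trans (ContinuousMap.dist_apply_le_dist t)).trans_lt (h b hb j)))
    (convex_ball _ _)

/-- The errors are the distance of the average from the reference path at time `t`, the same at time
`0`, and the distance from `e y` to `e a`; each is below `ε a`. -/
lemma path_mem (he : ∀ x y, dist (e x) (e y) ≤ dist x y) (hf : ∀ (a : A) j, f a j 0 = a) {y : U}
    {m : A → Equiv.Perm (Fin i)} (h : D.Good y m) (j : Fin i) (t : unitInterval) :
    D.path m j (y, t) ∈ O := by
  obtain ⟨a, ha, hm⟩ := h
  refine D.ball_subset a j t ?_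
  have h1 := D.avg_mem_ball he hm j t
  have h2 := D.avg_mem_ball he hm j 0
  rw [mem_ball_iff_norm] at h1 h2 ⊢
  have h3 : ‖e y - e a‖ < D.ε a := by
    rw [← dist_eq_norm]
    exact ((he _ _).trans_lt ha).trans_le (D.ρ_le a)
  rw [hf] at h2
  have h4 : ‖(1 - t : ℝ) • (e y - D.avg m j (y, 0))‖ ≤ ‖e y - e a‖ + ‖D.avg m j (y, 0) - e a‖ := by
    rw [norm_smul, Real.norm_of_nonneg (sub_nonneg.2 t.2.2),
      ← sub_sub_sub_cancel_right _ _ (e a)]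
    refine (mul_le_of_le_one_left (norm_nonneg _) ?_).trans (norm_sub_le _ _)
    linarith [t.2.1]
  have h5 : D.path m j (y, t) - e (f a j t)
      = (D.avg m j (y, t) - e (f a j t)) + (1 - t : ℝ) • (e y - D.avg m j (y, 0)) := by
    rw [path]; abel
  rw [h5]
  have h6 := norm_add_le (D.avg m j (y, t) - e (f a j t)) ((1 - t : ℝ) • (e y - D.avg m j (y, 0)))
  linarith

lemma continuous_avg (he : Continuous e) (m : A → Equiv.Perm (Fin i)) (j : Fin i) :
    Continuous (D.avg m j) := by
  refine continuous_finsum (fun b => ?_) ?_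
  · exact ((D.w b).continuous.comp continuous_fst).smul
      (he.comp ((f b (m b j)).continuous.comp continuous_snd))
  · refine (D.w.locallyFinite.preimage_continuous (g := fun q : U × unitInterval => q.1)
      continuous_fst).subset fun b q hq hb => hq ?_
    change D.w b q.1 • _ = (0 : E)
    rw [hb, zero_smul]

lemma continuous_path (he : Continuous e) (m : A → Equiv.Perm (Fin i)) (j : Fin i) :
    Continuous (D.path m j) := by
  have h := D.continuous_avg he m j
  refine h.add ((by fun_prop : Continuous fun q : U × unitInterval => (1 - q.2 : ℝ)).smul
    ((he.comp (continuous_subtype_val.comp continuous_fst)).sub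
      (h.comp (continuous_fst.prodMk continuous_const))))

lemma path_zero (m : A → Equiv.Perm (Fin i)) (j : Fin i) (y : U) : D.path m j (y, 0) = e y := by
  simp [path]

lemma path_one {x₀ : X} (hf : ∀ (a : A) j, f a j 1 = x₀) (m : A → Equiv.Perm (Fin i)) (j : Fin i)
    (y : U) : D.path m j (y, 1) = e x₀ := by
  simp only [path, avg, hf, Set.Icc.coe_one, sub_self, zero_smul, add_zero]
  rw [← finsum_smul, D.w.sum_eq_one (Set.mem_univ y), one_smul]

/-- The unordered average paths form a homotopy. -/
theorem exists_homotopy (D : AveragingData e O f U) (he : ∀ x y, dist (e x) (e y) ≤ dist x y)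
    (hO : IsOpen O) {r : E → X} (hr : ContinuousOn r O) (hre : ∀ x, r (e x) = x)
    (hf₀ : ∀ (a : A) j, f a j 0 = a) {x₀ : X} (hf₁ : ∀ (a : A) j, f a j 1 = x₀) :
    ∃ G : C(U × unitInterval, SymPower i X), (∀ y : U, G (y, 0) = symDiagonal i X y) ∧
      ∀ y, G (y, 1) = symDiagonal i X x₀ := by
  have hec : Continuous e := (LipschitzWith.of_dist_le_mul (K := 1) fun x y => by
    simpa using he x y).continuous
  -- The matching is chosen pointwise without continuity. Good matchings at `y` differ by one
  -- permutation, so the class in the symmetric power is independent of the choice, and near each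
  -- point a fixed matching computes it.
  have hex : ∀ y : U, ∃ m, D.Good y m := fun y => by
    obtain ⟨m, hm⟩ := D.exists_good y
    exact ⟨m, hm.self_of_nhds⟩
  choose M hM using hex
  let g : (A → Equiv.Perm (Fin i)) → U × unitInterval → SymPower i X :=
    fun m q => Quotient.mk (symSetoid i X) fun j => r (D.path m j q)
  have hg : ∀ (q : U × unitInterval) (m : A → Equiv.Perm (Fin i)), D.Good q.1 m →
      g (M q.1) q = g m q := by
    rintro ⟨y, t⟩ m hm
    obtain ⟨s, hs⟩ := hm.exists_perm D (hM y)
    refine (Quotient.sound ⟨s, ?_⟩)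
    funext j
    simp only [path, Function.comp_apply, D.avg_eq_of_perm hs]
  refine ⟨⟨fun q => g (M q.1) q, continuous_iff_continuousAt.2 fun q => ?_⟩, fun y => ?_,
    fun y => ?_⟩
  · obtain ⟨m, hm⟩ := D.exists_good q.1
    have hm' : ∀ᶠ z : U × unitInterval in nhds q, D.Good z.1 m :=
      continuous_fst.continuousAt.eventually hm
    have hcont : ContinuousAt (g m) q := by
      refine ContinuousAt.comp (f := fun q j => r (D.path m j q))
        (g := Quotient.mk (symSetoid i X)) continuous_quotient_mk'.continuousAt ?_
      refine continuousAt_pi.2 fun j => ?_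
      have hq : D.path m j q ∈ O := D.path_mem he hf₀ hm.self_of_nhds j q.2
      exact ContinuousAt.comp (hr.continuousAt (hO.mem_nhds hq))
        (D.continuous_path hec m j).continuousAt
    refine hcont.congr ?_
    filter_upwards [hm'] with z hz
    exact (hg z m hz).symm
  · change Quotient.mk (symSetoid i X) _ = Quotient.mk (symSetoid i X) _
    simp only [path_zero, hre]
  · change Quotient.mk (symSetoid i X) _ = Quotient.mk (symSetoid i X) _
    simp only [D.path_one hf₁, hre]

end AveragingData

variable [NormedSpace ℝ E]

/-- A family of configurations of `i` distinct paths, the paths of `f a` leading from `a ∈ A` to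
`x₀`, which depends continuously on `a` up to the order of the paths, gives rise to a
homotopy from the diagonal of `SPⁱ(X)` to a constant map on a neighbourhood of `A`. -/
theorem exists_open_homotopy_symPower (he : ∀ x y, dist (e x) (e y) ≤ dist x y) (hO : IsOpen O)
    (heO : ∀ x, e x ∈ O) {r : E → X} (hr : ContinuousOn r O) (hre : ∀ x, r (e x) = x)
    (hf₀ : ∀ (a : A) j, f a j 0 = a) {x₀ : X} (hf₁ : ∀ (a : A) j, f a j 1 = x₀)
    (hinj : ∀ a : A, Function.Injective (f a))
    (hloc : ∀ a : A, ∀ ε > 0, ∃ ρ > 0, ∀ b : A, dist (a : X) b < ρ →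
      ∃ s : Equiv.Perm (Fin i), ∀ j, dist (f b (s j)) (f a j) < ε) :
    ∃ U : Set X, IsOpen U ∧ A ⊆ U ∧ ∃ G : C(U × unitInterval, SymPower i X),
      (∀ y : U, G (y, 0) = symDiagonal i X y) ∧ ∀ y, G (y, 1) = symDiagonal i X x₀ := by
  have hec : Continuous e := (LipschitzWith.of_dist_le_mul (K := 1) fun x y => by
    simpa using he x y).continuous
  choose ε hε hsep hball using fun a => exists_pos_separated hec hO heO (hinj a)
  choose ρ hρ hperm using fun a => hloc a (ε a) (hε a)
  -- Halved because reference points of two overlapping balls can be almost twice the radius apart;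
  -- bounded by `ε a` to control the starting-point error.
  let ρ' : A → ℝ := fun a => min (ρ a / 2) (ε a)
  have hρ' : ∀ a, 0 < ρ' a := fun a => lt_min (half_pos (hρ a)) (hε a)
  let U : Set X := ⋃ a : A, Metric.ball (a : X) (ρ' a)
  obtain ⟨w, hw⟩ := PartitionOfUnity.exists_isSubordinate (X := U) isClosed_univ
    (fun a : A => {y : U | dist (y : X) a < ρ' a})
    (fun a => isOpen_lt (by fun_prop) continuous_const)
    (fun y _ => by
      obtain ⟨a, ha⟩ := Set.mem_iUnion.1 y.2
      exact Set.mem_iUnion.2 ⟨a, ha⟩)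
  let D : AveragingData e O f U :=
    { ε := ε
      ρ := ρ'
      ρ_le := fun a => min_le_right _ _
      separated := hsep
      ball_subset := hball
      exists_perm := fun a b h => hperm a b (h.trans_le (by
        have := min_le_left (ρ a / 2) (ε a)
        change 2 * min (ρ a / 2) (ε a) ≤ _
        linarith))
      w := w
      subordinate := hw }
  exact ⟨U, isOpen_iUnion fun a => Metric.isOpen_ball,
    fun a ha => Set.mem_iUnion.2 ⟨⟨a, ha⟩, Metric.mem_ball_self (hρ' _)⟩,
    D.exists_homotopy he hO hr hre hf₀ hf₁⟩

end Averaging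

/-! ## Supports of finitely supported measures -/

section Support

lemma exists_pos_le_dist {Z : Type*} [MetricSpace Z] {i : ℕ} {p : Fin i → Z}
    (hp : Function.Injective p) :
    ∃ δ > 0, ∀ j l, j ≠ l → δ ≤ dist (p j) (p l) := by
  have h1 : ∀ j l, ∀ᶠ δ : ℝ in nhdsWithin 0 (Set.Ioi 0), j ≠ l → δ ≤ dist (p j) (p l) := by
    intro j l
    by_cases h : j = l
    · exact Filter.Eventually.of_forall fun _ h' => absurd h h'
    · filter_upwards [nhdsWithin_le_nhds (eventually_lt_nhds (dist_pos.2 (hp.ne h)))] with δ hδ _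
      exact hδ.le
  obtain ⟨δ, h, hδ⟩ := ((Filter.eventually_all.2 fun j => Filter.eventually_all.2 (h1 j)).and
    self_mem_nhdsWithin).exists
  exact ⟨δ, hδ, h⟩

variable {k : ℕ} {Z : Type u} [MetricSpace Z] [MeasurableSpace Z] [BorelSpace Z]

lemma FinMeasures.exists_supp_subset (μ : FinMeasures k Z) :
    ∃ F : Finset Z, F.card ≤ k ∧ μ.supp ⊆ F := by
  obtain ⟨F, hF, h⟩ := μ.2
  refine ⟨F, hF, fun z hz => ?_⟩
  by_contra hzF
  exact hz (measure_mono_null (Set.singleton_subset_iff.2 hzF) h)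

lemma FinMeasures.finite_supp (μ : FinMeasures k Z) : μ.supp.Finite := by
  obtain ⟨F, -, h⟩ := μ.exists_supp_subset
  exact F.finite_toSet.subset h

lemma FinMeasures.ncard_supp_le (μ : FinMeasures k Z) : μ.supp.ncard ≤ k := by
  obtain ⟨F, hF, h⟩ := μ.exists_supp_subset
  exact (Set.ncard_le_ncard h F.finite_toSet).trans ((Set.ncard_coe_finset F).le.trans hF)

lemma FinMeasures.measure_compl_supp (μ : FinMeasures k Z) :
    (μ.1.toMeasure : Measure Z) μ.suppᶜ = 0 := by
  obtain ⟨F, -, h⟩ := μ.2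
  have h1 : (μ.1.toMeasure : Measure Z) (⋃ z ∈ {z | z ∈ F ∧ z ∉ μ.supp}, {z}) = 0 := by
    refine (measure_biUnion_null_iff ((F.finite_toSet.subset fun z hz => hz.1).countable)).2 ?_
    intro z hz
    by_contra hne
    exact hz.2 hne
  refine measure_mono_null (fun z hz => ?_) (measure_union_null h h1)
  by_cases hzF : z ∈ F
  · exact .inr (Set.mem_biUnion (show z ∈ {z | z ∈ F ∧ z ∉ μ.supp} from ⟨hzF, hz⟩) rfl)
  · exact .inl hzF

lemma FinMeasures.exists_mem_supp (μ : FinMeasures k Z) {B : Set Z}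
    (hB : (μ.1.toMeasure : Measure Z) B ≠ 0) : ∃ z ∈ B, z ∈ μ.supp := by
  by_contra! h
  exact hB (measure_mono_null h μ.measure_compl_supp)

lemma FinMeasures.ncard_supp_pos (μ : FinMeasures k Z) : 0 < μ.supp.ncard := by
  rw [Set.ncard_pos μ.finite_supp]
  obtain ⟨z, -, hz⟩ := μ.exists_mem_supp (B := Set.univ) (by
    rw [measure_univ]
    exact one_ne_zero)
  exact ⟨z, hz⟩

/-- The atoms of a finitely supported measure are close to atoms of all measures near it. -/
lemma FinMeasures.eventually_exists_mem_supp (μ : FinMeasures k Z) {ε : ℝ} (hε : 0 < ε) :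
    ∀ᶠ ν in nhds μ, ∀ z ∈ μ.supp, ∃ z' ∈ ν.supp, dist z' z < ε := by
  refine (Filter.eventually_all_finite μ.finite_supp).2 fun z hz => ?_
  set w := ((μ.1.toMeasure : Measure Z) {z}).toReal with hw
  have hfin : (μ.1.toMeasure : Measure Z) {z} ≠ ⊤ := measure_ne_top _ _
  have hw0 : 0 < w := ENNReal.toReal_pos hz hfin
  -- With distance below `w / 2`, a null `ε`-ball about `z` would force `w ≤ w / 2`.
  have hδ : 0 < min ε (w / 2) := lt_min hε (half_pos hw0)
  filter_upwards [Metric.eball_mem_nhds μ (ENNReal.ofReal_pos.2 hδ)] with ν hν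
  have hd : levyProkhorovEDist (μ.1.toMeasure : Measure Z) (ν.1.toMeasure : Measure Z)
      < ENNReal.ofReal (min ε (w / 2)) := by
    rw [levyProkhorovEDist_comm]
    exact hν
  have h1 := left_measure_le_of_levyProkhorovEDist_lt hd (MeasurableSet.singleton z)
  rw [ENNReal.toReal_ofReal hδ.le] at h1
  obtain ⟨z', hz', hzs⟩ := ν.exists_mem_supp
    (B := Metric.thickening (min ε (w / 2)) {z}) (by
      intro h0
      rw [h0, zero_add, ← ENNReal.ofReal_toReal hfin, ENNReal.ofReal_le_ofReal_iff hδ.le] at h1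
      have := min_le_right ε (w / 2)
      linarith)
  rw [Metric.thickening_singleton] at hz'
  exact ⟨z', hzs, (Metric.mem_ball.1 hz').trans_le (min_le_left _ _)⟩

/-- The support depends continuously on the measure where its cardinality is constant. -/
lemma FinMeasures.eventually_exists_perm (μ : FinMeasures k Z) {i : ℕ} {p : Fin i → Z}
    (hp : Function.Injective p) (hpμ : Set.range p = μ.supp) {ε : ℝ} (hε : 0 < ε) :
    ∀ᶠ ν in nhds μ, ∀ q : Fin i → Z, Set.range q = ν.supp →
      ∃ s : Equiv.Perm (Fin i), ∀ j, dist (q (s j)) (p j) < ε := by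
  obtain ⟨δ, hδ, hsep⟩ := exists_pos_le_dist hp
  filter_upwards [μ.eventually_exists_mem_supp (lt_min hε (half_pos hδ))] with ν hν q hq
  have hex : ∀ j, ∃ l, dist (q l) (p j) < min ε (δ / 2) := by
    intro j
    obtain ⟨z, hz, hd⟩ := hν (p j) (hpμ ▸ Set.mem_range_self j)
    obtain ⟨l, rfl⟩ := hq.symm ▸ hz
    exact ⟨l, hd⟩
  choose s hs using hex
  -- One atom cannot be within `δ / 2` of two `δ`-separated atoms. Equal cardinalities then make the
  -- choice a bijection.
  have hinj : Function.Injective s := by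
    intro j l hjl
    by_contra hne
    have h1 := hsep j l hne
    have h2 := (hs j).trans_le (min_le_right _ _)
    have h3 := (hs l).trans_le (min_le_right _ _)
    rw [hjl] at h2
    have h4 := dist_triangle_left (p j) (p l) (q (s l))
    linarith
  exact ⟨Equiv.ofBijective s (Finite.injective_iff_bijective.1 hinj),
    fun j => (hs j).trans_le (min_le_left _ _)⟩

end Support

/-! ## The lower bound for the distributional category -/

/-- If `i` divides `m`, the repetition of coordinates maps `SPⁱ(X)` to `SPᵐ(X)` and respects the
diagonals. -/
lemma exists_symPower_map (X : Type u) [TopologicalSpace X] {i m : ℕ} (h : i ∣ m) :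
    ∃ φ : C(SymPower i X, SymPower m X), ∀ x, φ (symDiagonal i X x) = symDiagonal m X x := by
  obtain ⟨l, rfl⟩ := h
  let q : Fin (i * l) → Fin i := fun j => (finProdFinEquiv.symm j).1
  have hq : ∀ x y : Fin i → X, (symSetoid i X) x y → (symSetoid (i * l) X) (x ∘ q) (y ∘ q) := by
    rintro x _ ⟨s, rfl⟩
    refine ⟨finProdFinEquiv.symm.trans
      ((s.prodCongr (Equiv.refl (Fin l))).trans finProdFinEquiv), ?_⟩
    funext j
    simp only [q, Function.comp_apply, Equiv.trans_apply, Equiv.symm_apply_apply]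
    rfl
  exact ⟨⟨Quotient.map (fun x => x ∘ q) hq, continuous_quotient_mk'.comp
    (continuous_pi fun j => continuous_apply (q j)) |>.quotient_lift _⟩, fun x => rfl⟩

/-- A distributed contraction of an absolute neighbourhood retract yields homotopies from the
diagonals of the symmetric powers to constant maps, on open neighbourhoods of the sets of points
where the size of the support is constant. -/
theorem exists_open_homotopy_of_distHomotopy {X : Type u} [MetricSpace X] (hX : IsANR X) {k : ℕ}
    {x₀ : X} (H : DistHomotopy k (ContinuousMap.id X) (ContinuousMap.const X x₀)) (i : ℕ) :
    ∃ U : Set X, IsOpen U ∧ {x | (H.toMap x).supp.ncard = i} ⊆ U ∧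
      ∃ G : C(U × unitInterval, SymPower i X), (∀ y : U, G (y, 0) = symDiagonal i X y) ∧
        ∀ y, G (y, 1) = symDiagonal i X x₀ := by
  obtain ⟨O, hO, heO, r, hr, hre⟩ := hX (LipSpan X) lipEmbed isClosedEmbedding_lipEmbed
  have hex : ∀ a : {x | (H.toMap x).supp.ncard = i}, ∃ p : Fin i → C(unitInterval, X),
      Function.Injective p ∧ Set.range p = (H.toMap a).supp := by
    rintro ⟨a, ha⟩
    have := (H.toMap a).finite_supp.to_subtype
    let E : Fin i ≃ (H.toMap a).supp := (Finite.equivFinOfCardEq ha).symm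
    exact ⟨fun j => (E j).1, Subtype.val_injective.comp E.injective,
      (E.surjective.range_comp Subtype.val).trans Subtype.range_val⟩
  choose f hinj hrange using hex
  have hend : ∀ (a : {x | (H.toMap x).supp.ncard = i}) (j : Fin i),
      f a j 0 = (a : X) ∧ f a j 1 = x₀ := fun a j =>
    H.endpoints a (f a j) (hrange a ▸ Set.mem_range_self j)
  refine exists_open_homotopy_symPower (f := f) dist_lipEmbed_le hO (fun x => heO ⟨x, rfl⟩) hr hre
    (fun a j => (hend a j).1) (fun a j => (hend a j).2) hinj fun a ε hε => ?_
  have h1 := H.toMap.continuous.continuousAt.eventually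
    ((H.toMap a).eventually_exists_perm (hinj a) (hrange a) hε)
  obtain ⟨ρ, hρ, h⟩ := Metric.eventually_nhds_iff.1 h1
  exact ⟨ρ, hρ, fun b hb => h (by rwa [dist_comm]) (f b) (hrange b)⟩

end DCat

end

theorem mainTheorem2 (X : Type u) [MetricSpace X] [PathConnectedSpace X]
    (hX : DCat.IsANR X) (R : Type v) [Ring R]
    (n : ℕ) (k : Fin n → ℕ) (hk : ∀ i, 1 ≤ k i)
    (αStar : ∀ i, DCat.SingularCohomology (k i) (DCat.SymPower n.factorial X) R)
    (α : ∀ i, DCat.SingularCohomology (k i) X R)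
    (hα : ∀ i, α i = DCat.singularPullback R (DCat.symDiagonal n.factorial X) (k i) (αStar i))
    (hcup : (DCat.cupProd (List.ofFn fun i => ⟨k i, α i⟩)).2 ≠ 0) :
    (n : ℕ∞) ≤ DCat.dcat X := by
  refine le_iInf₂ fun m ⟨x₀, ⟨H⟩⟩ => ?_
  rw [Nat.cast_le]
  by_contra! hmn
  obtain ⟨n, rfl⟩ : ∃ l, n = l + 1 := ⟨n - 1, by omega⟩
  -- Supports are nonempty, so index `i : Fin (n + 1)` stands for support size `i + 1`. The sizes
  -- `1, …, n + 1` suffice because `m + 1 ≤ n + 1`.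
  choose U hU hAU G hG₀ hG₁ using fun i : Fin (n + 1) =>
    DCat.exists_open_homotopy_of_distHomotopy hX H (i + 1)
  refine hcup (DCat.cupProd_eq_zero n k (hk 0) α U hU (fun x => ?_) fun i => ?_)
  · have h1 := (H.toMap x).ncard_supp_pos
    have h2 := (H.toMap x).ncard_supp_le
    refine ⟨⟨(H.toMap x).supp.ncard - 1, by omega⟩, hAU _ ?_⟩
    change (H.toMap x).supp.ncard = (H.toMap x).supp.ncard - 1 + 1
    omega
  · obtain ⟨φ, hφ⟩ := DCat.exists_symPower_map X
      (Nat.dvd_factorial (Nat.succ_pos i) i.2 : (i : ℕ) + 1 ∣ (n + 1).factorial)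
    rw [hα]
    refine DCat.hasRepVanishingOn_singularPullback _ (φ.comp (G i))
      (p := DCat.symDiagonal _ X x₀) (fun y => ?_) (fun y => ?_) (hk i) _
    · rw [ContinuousMap.comp_apply, hG₀, hφ]
    · rw [ContinuousMap.comp_apply, hG₁, hφ]
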